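/- Let $\mathbb S^3\subset\mathbb H$ be the unit quaternions and, for $Z=(U,V)\in T_{(p,q)}(\mathbb S^3\times\mathbb S^3)$, put $$JZ=\tfrac1{\sqrt3}\bigl(2pq^{-1}V-U,\,-2qp^{-1}U+V\bigr),\qquad PZ=(pq^{-1}V,\,qp^{-1}U),\qquad g(Z,Z')=\tfrac12\bigl(\langle Z,Z'\rangle+\langle JZ,JZ'\rangle\bigr),$$ where $\langle\cdot,\cdot\rangle$ is the Euclidean product metric. Let $\tilde\nabla$ be the Levi-Civita connection of $g$ and $G(X,Y)=(\tilde\nabla_XJ)Y$. Let $M$ be a Lagrangian submanifold of $(\mathbb S^3\times\mathbb S^3,g,J)$, that is, a smooth $3$-manifold with a smooth immersion into $\mathbb S^3\times\mathbb S^3$ such that $J$ maps tangent vectors of $M$ to normal vectors. We identify tangent vectors of $M$ with their images under the differential of the immersion. Let $h(X,Y)=(\tilde\nabla_XY)^\perp$ be the second fundamental form, and let $A,B$ be the endomorphisms of $TM$ determined by $PX=AX+JBX$ for $X\in TM$. If $M$, with the induced metric, has constant sectional curvature, then for all vectors $W,X,Y,Z$ tangent to $M$ at a point $$\begin{aligned}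 \underset{WXY}{\mathfrak S}\Bigl\{&\bigl\{g(JG(Y,W),AZ)+\tfrac12g(JG(Y,Z),AW)-\tfrac12g(JG(W,Z),AY)+g(h(W,Z),JBY)-g(h(Y,Z),JBW)\bigr\}\,JBX\\ &+\bigl\{g(JG(W,Y),BZ)+\tfrac12g(JG(W,Z),BY)-\tfrac12g(JG(Y,Z),BW)+g(h(W,Z),JAY)-g(h(Y,Z),JAW)\bigr\}\,JAX\\ &+g(AX,Z)\bigl\{JBJG(W,Y)+\tfrac12G(Y,BW)-\tfrac12G(W,BY)+h(W,AY)-h(Y,AW)\bigr\}\\ &+g(BX,Z)\bigl\{-JAJG(W,Y)+\tfrac12G(W,AY)-\tfrac12G(Y,AW)+h(W,BY)-h(Y,BW)\bigr\}\Bigr\}=0, \end{aligned}$$ where $\mathfrak S_{WXY}$ denotes the sum over the cyclic permutations of $W,X,Y$ (with $Z$ fixed). Here $JG(W,Y)$ is tangent to $M$, so that $A$ and $B$ can be applied to it. -/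

import Mathlib

open scoped Quaternion Manifold ContDiff InnerProductSpace

namespace NK

/-! ### The nearly Kähler `S³ × S³`

The ambient ring is `ℍ × ℍ` with componentwise operations; `S³ × S³` is the group of pairs of unit
quaternions in it.  A tangent vector at `z = (p, q)` is a pair `Z = (U, V)` of quaternions with
`U ⊥ p` and `V ⊥ q`. -/

/-- The ambient space `ℍ × ℍ`. -/
abbrev HH : Type := ℍ[ℝ] × ℍ[ℝ]

/-- `S³ × S³` as a subset of `ℍ × ℍ`. -/
def S3S3 : Set HH := {z | ‖z.1‖ = 1 ∧ ‖z.2‖ = 1}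

/-- The usual Euclidean product metric. -/
noncomputable def euc (Z Z' : HH) : ℝ := ⟪Z.1, Z'.1⟫_ℝ + ⟪Z.2, Z'.2⟫_ℝ

/-- The almost complex structure
`J (U, V) = (2 p q⁻¹ V - U, -2 q p⁻¹ U + V) / √3` at `z = (p, q)`. -/
noncomputable def J (z Z : HH) : HH :=
  (1 / √3 : ℝ) • ((2 : ℝ) • (z.1 * z.2⁻¹ * Z.2) - Z.1, (-2 : ℝ) • (z.2 * z.1⁻¹ * Z.1) + Z.2)

/-- The almost product structure `P (U, V) = (p q⁻¹ V, q p⁻¹ U)` at `z = (p, q)`. -/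
noncomputable def P (z Z : HH) : HH := (z.1 * z.2⁻¹ * Z.2, z.2 * z.1⁻¹ * Z.1)

/-- The nearly Kähler metric: the Hermitian metric associated with the Euclidean one. -/
noncomputable def g (z Z Z' : HH) : ℝ := (1 / 2) * (euc Z Z' + euc (J z Z) (J z Z'))

/-- The Levi-Civita product on the Lie algebra `Im ℍ ⊕ Im ℍ`: the value at the identity of
`∇̃_u v` for left-invariant vector fields `u = (a, b)` and `v = (a', b')`. -/
noncomputable def lcProd (u v : HH) : HH :=
  ((1 / 2 : ℝ) • ⁅u.1, v.1⁆ - (1 / 6 : ℝ) • ⁅u.1, v.2⁆ + (1 / 6 : ℝ) • ⁅u.2, v.1⁆,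
   (1 / 2 : ℝ) • ⁅u.2, v.2⁆ + (1 / 6 : ℝ) • ⁅u.1, v.2⁆ - (1 / 6 : ℝ) • ⁅u.2, v.1⁆)

theorem mul_ne {z : HH} (hz : z ∈ S3S3) : z.1 ≠ 0 ∧ z.2 ≠ 0 :=
  ⟨norm_ne_zero_iff.1 (by rw [hz.1]; exact one_ne_zero),
    norm_ne_zero_iff.1 (by rw [hz.2]; exact one_ne_zero)⟩

theorem mul_inv_self {z : HH} (hz : z ∈ S3S3) (u : HH) : z * (z⁻¹ * u) = u := by
  obtain ⟨h1, h2⟩ := mul_ne hz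
  ext1 <;> simp [h1, h2]

theorem inv_mul_self {z : HH} (hz : z ∈ S3S3) (u : HH) : z⁻¹ * (z * u) = u := by
  obtain ⟨h1, h2⟩ := mul_ne hz
  ext1 <;> simp [h1, h2]

/-- `J` is left invariant. -/
theorem J_mul {z : HH} (hz : z ∈ S3S3) (u : HH) : J z (z * u) = z * J 1 u := by
  obtain ⟨h1, h2⟩ := mul_ne hz
  ext1 <;> simp [J, h1, h2, mul_assoc, mul_add, mul_sub]

theorem inner_mul_left_unit {p : ℍ[ℝ]} (hp : ‖p‖ = 1) (a b : ℍ[ℝ]) :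
    ⟪p * a, p * b⟫_ℝ = ⟪a, b⟫_ℝ := by
  have h := @real_inner_eq_norm_add_mul_self_sub_norm_mul_self_sub_norm_mul_self_div_two ℍ[ℝ] _ _
  rw [h, h, ← mul_add, norm_mul, norm_mul, norm_mul, hp]
  simp

/-- The metric is left invariant. -/
theorem g_mul {z : HH} (hz : z ∈ S3S3) (u v : HH) : g z (z * u) (z * v) = g 1 u v := by
  simp only [g, J_mul hz, euc, Prod.fst_mul, Prod.snd_mul, inner_mul_left_unit hz.1,
    inner_mul_left_unit hz.2]

theorem g_one (u v : HH) : g 1 u v =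
    4 / 3 * (⟪u.1, v.1⟫_ℝ + ⟪u.2, v.2⟫_ℝ) - 2 / 3 * (⟪u.1, v.2⟫_ℝ + ⟪v.1, u.2⟫_ℝ) := by
  have h3 : (√3)⁻¹ * (√3)⁻¹ = (1 / 3 : ℝ) := by
    rw [← mul_inv, Real.mul_self_sqrt (by norm_num)]; norm_num
  simp only [g, euc, J, Quaternion.inner_def]
  simp
  linear_combination (h3 * (5 / 2 * (u.1.re * v.1.re + u.1.imI * v.1.imI + u.1.imJ * v.1.imJ +
    u.1.imK * v.1.imK + u.2.re * v.2.re + u.2.imI * v.2.imI + u.2.imJ * v.2.imJ +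
    u.2.imK * v.2.imK) - 2 * (u.1.re * v.2.re + u.1.imI * v.2.imI + u.1.imJ * v.2.imJ +
    u.1.imK * v.2.imK + u.2.re * v.1.re + u.2.imI * v.1.imI + u.2.imJ * v.1.imJ +
    u.2.imK * v.1.imK)))

theorem lcProd_symm (u v : HH) : lcProd u v - lcProd v u = u * v - v * u := by
  ext <;> simp [lcProd, Ring.lie_def] <;> ring

theorem lcProd_metric (u v w : HH) : g 1 (lcProd u v) w + g 1 v (lcProd u w) = 0 := by
  simp only [g_one, Quaternion.inner_def]
  simp [lcProd, Ring.lie_def]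
  ring

/-- The metric in terms of the Euclidean metric of `ℍ`. -/
theorem g_eq {z : HH} (hz : z ∈ S3S3) (Z Z' : HH) : g z Z Z' =
    4 / 3 * (⟪Z.1, Z'.1⟫_ℝ + ⟪Z.2, Z'.2⟫_ℝ)
      - 2 / 3 * (⟪z.1⁻¹ * Z.1, z.2⁻¹ * Z'.2⟫_ℝ + ⟪z.1⁻¹ * Z'.1, z.2⁻¹ * Z.2⟫_ℝ) := by
  rw [← mul_inv_self hz Z, ← mul_inv_self hz Z', g_mul hz, g_one]
  simp only [Prod.fst_mul, Prod.snd_mul, inner_mul_left_unit hz.1, inner_mul_left_unit hz.2]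
  have h1 := (mul_ne hz).1
  have h2 := (mul_ne hz).2
  simp [h1, h2]

section Along

variable {V : Type*} [NormedAddCommGroup V] [NormedSpace ℝ V]

/-- The Levi-Civita connection `∇̃` of `(S³ × S³, g)`, for vector fields along a map: `nabla F Y x v`
is the covariant derivative at `x` in the direction `v` of the field `Y` along `F : V → S³ × S³`.
After left translation of `Y` to the identity it is the derivative plus the Levi-Civita product.
The facts `nabla_comp` (naturality), `nabla_smul` (Leibniz rule), `nabla_symm` (no torsion) and `nabla_metric` (compatibility
with `g`) below characterize it as the Levi-Civita connection. -/
noncomputable def nabla (F Y : V → HH) (x v : V) : HH :=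
  F x * (fderiv ℝ (fun y => (F y)⁻¹ * Y y) x v
    + lcProd ((F x)⁻¹ * fderiv ℝ F x v) ((F x)⁻¹ * Y x))

theorem hasFDerivAt_inv {F : V → HH} {x : V} (hF : DifferentiableAt ℝ F x) (h1 : (F x).1 ≠ 0)
    (h2 : (F x).2 ≠ 0) : ∃ L : V →L[ℝ] HH, HasFDerivAt (fun y => (F y)⁻¹) L x ∧
      ∀ v, L v = -((F x)⁻¹ * fderiv ℝ F x v * (F x)⁻¹) := by
  have a1 := ((hasFDerivAt_inv' (𝕜 := ℝ) h1).comp x hF.hasFDerivAt.fst)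
  have a2 := ((hasFDerivAt_inv' (𝕜 := ℝ) h2).comp x hF.hasFDerivAt.snd)
  refine ⟨_, a1.prodMk a2, fun v => ?_⟩
  ext1 <;> simp

/-- Derivative of the left translate. -/
theorem fderiv_inv_mul {F Y : V → HH} {x : V} (hF : DifferentiableAt ℝ F x)
    (hY : DifferentiableAt ℝ Y x) (h1 : (F x).1 ≠ 0) (h2 : (F x).2 ≠ 0) (v : V) :
    fderiv ℝ (fun y => (F y)⁻¹ * Y y) x v =
      (F x)⁻¹ * fderiv ℝ Y x v - (F x)⁻¹ * fderiv ℝ F x v * (F x)⁻¹ * Y x := by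
  obtain ⟨L, hL, hL'⟩ := hasFDerivAt_inv hF h1 h2
  have := hL.fun_mul' hY.hasFDerivAt
  rw [this.fderiv]
  simp [hL', sub_eq_add_neg]

/-- Naturality. -/
theorem nabla_comp {F : V → HH} {Y : HH → HH} {x : V} (hF : DifferentiableAt ℝ F x)
    (hx : F x ∈ S3S3) (hY : DifferentiableAt ℝ Y (F x)) (v : V) :
    nabla F (fun y => Y (F y)) x v = nabla (fun w => w) Y (F x) (fderiv ℝ F x v) := by
  obtain ⟨h1, h2⟩ := mul_ne hx
  have hYF : fderiv ℝ (fun y => Y (F y)) x v = fderiv ℝ Y (F x) (fderiv ℝ F x v) := by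
    rw [(hY.hasFDerivAt.comp x hF.hasFDerivAt).fderiv (f := fun y => Y (F y))]; rfl
  have hd : DifferentiableAt ℝ (fun y => Y (F y)) x :=
    (hY.hasFDerivAt.comp x hF.hasFDerivAt).differentiableAt
  simp only [nabla]
  rw [fderiv_inv_mul hF hd h1 h2, fderiv_inv_mul (F := fun w => w) differentiableAt_id hY h1 h2, hYF]
  simp

/-- The Leibniz rule. -/
theorem nabla_smul {F Y : V → HH} {φ : V → ℝ} {x : V} (hF : DifferentiableAt ℝ F x)
    (hY : DifferentiableAt ℝ Y x) (hφ : DifferentiableAt ℝ φ x) (hx : F x ∈ S3S3) (v : V) :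
    nabla F (fun y => φ y • Y y) x v = fderiv ℝ φ x v • Y x + φ x • nabla F Y x v := by
  obtain ⟨h1, h2⟩ := mul_ne hx
  obtain ⟨L, hL, -⟩ := hasFDerivAt_inv hF h1 h2
  have hd := (hL.fun_mul' hY.hasFDerivAt).differentiableAt
  have : (fun y => (F y)⁻¹ * φ y • Y y) = fun y => φ y • ((F y)⁻¹ * Y y) := by
    ext1 y; rw [mul_smul_comm]
  have hl : ∀ (u w : HH) (c : ℝ), lcProd u (c • w) = c • lcProd u w := by
    intro u w c
    ext <;> simp [lcProd, Ring.lie_def] <;> ring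
  simp only [nabla]
  rw [this, fderiv_fun_smul hφ hd, mul_smul_comm, hl]
  simp [mul_add, smul_add, mul_inv_self hx]
  abel

/-- The connection has no torsion. -/
theorem nabla_symm {F : V → HH} {x : V} (hF : ContDiffAt ℝ 2 F x) (hx : F x ∈ S3S3) (u v : V) :
    nabla F (fun y => fderiv ℝ F y v) x u = nabla F (fun y => fderiv ℝ F y u) x v := by
  obtain ⟨h1, h2⟩ := mul_ne hx
  have hF1 : DifferentiableAt ℝ F x := hF.differentiableAt (by norm_num)
  have hF2 : DifferentiableAt ℝ (fderiv ℝ F) x :=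
    (hF.fderiv_right (m := 1) (by norm_num)).differentiableAt (by norm_num)
  have hd : ∀ w, DifferentiableAt ℝ (fun y => fderiv ℝ F y w) x := fun w =>
    hF2.clm_apply (differentiableAt_const w)
  have hdd : ∀ w w', fderiv ℝ (fun y => fderiv ℝ F y w) x w' = fderiv ℝ (fderiv ℝ F) x w' w := by
    intro w w'
    rw [fderiv_clm_apply hF2 (differentiableAt_const w)]
    simp
  have hs : fderiv ℝ (fderiv ℝ F) x u v = fderiv ℝ (fderiv ℝ F) x v u :=
    (hF.isSymmSndFDerivAt (by simp)) u v
  have hl := lcProd_symm ((F x)⁻¹ * fderiv ℝ F x u) ((F x)⁻¹ * fderiv ℝ F x v)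
  simp only [nabla]
  rw [fderiv_inv_mul hF1 (hd v) h1 h2, fderiv_inv_mul hF1 (hd u) h1 h2, hdd, hdd, hs]
  congr 1
  rw [sub_eq_iff_eq_add] at hl
  rw [hl]
  noncomm_ring

/-- The connection is compatible with the metric. -/
theorem nabla_metric {F Y Z : V → HH} {x : V} (hF : DifferentiableAt ℝ F x)
    (hY : DifferentiableAt ℝ Y x) (hZ : DifferentiableAt ℝ Z x)
    (hx : ∀ᶠ y in nhds x, F y ∈ S3S3) (v : V) :
    fderiv ℝ (fun y => g (F y) (Y y) (Z y)) x v =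
      g (F x) (nabla F Y x v) (Z x) + g (F x) (Y x) (nabla F Z x v) := by
  have hx0 := hx.self_of_nhds
  obtain ⟨h1, h2⟩ := mul_ne hx0
  obtain ⟨L, hL, -⟩ := hasFDerivAt_inv hF h1 h2
  have hy := (hL.fun_mul' hY.hasFDerivAt).differentiableAt
  have hz := (hL.fun_mul' hZ.hasFDerivAt).differentiableAt
  set y' : V → HH := fun y => (F y)⁻¹ * Y y with hy'
  set z' : V → HH := fun y => (F y)⁻¹ * Z y with hz'
  have key : (fun y => g (F y) (Y y) (Z y)) =ᶠ[nhds x] fun y => g 1 (y' y) (z' y) := by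
    filter_upwards [hx] with y hy
    rw [← g_mul hy, hy', hz', mul_inv_self hy, mul_inv_self hy]
  have e1 : g (F x) (nabla F Y x v) (Z x) = g 1 (fderiv ℝ y' x v +
      lcProd ((F x)⁻¹ * fderiv ℝ F x v) (y' x)) (z' x) := by
    rw [← g_mul hx0, hz', mul_inv_self hx0]; rfl
  have e2 : g (F x) (Y x) (nabla F Z x v) = g 1 (y' x) (fderiv ℝ z' x v +
      lcProd ((F x)⁻¹ * fderiv ℝ F x v) (z' x)) := by
    rw [← g_mul hx0, hy', mul_inv_self hx0]; rfl
  rw [key.fderiv_eq, e1, e2]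
  have hm := lcProd_metric ((F x)⁻¹ * fderiv ℝ F x v) (y' x) (z' x)
  have hD : fderiv ℝ (fun y => g 1 (y' y) (z' y)) x v =
      g 1 (fderiv ℝ y' x v) (z' x) + g 1 (y' x) (fderiv ℝ z' x v) := by
    have ya := hy.hasFDerivAt.fst
    have yb := hy.hasFDerivAt.snd
    have za := hz.hasFDerivAt.fst
    have zb := hz.hasFDerivAt.snd
    have h := (((ya.inner ℝ za).add (yb.inner ℝ zb)).const_mul (4 / 3)).sub
      (((ya.inner ℝ zb).add (za.inner ℝ yb)).const_mul (2 / 3))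
    have hh : (fun y => g 1 (y' y) (z' y)) = fun y =>
      4 / 3 * (⟪(y' y).1, (z' y).1⟫_ℝ + ⟪(y' y).2, (z' y).2⟫_ℝ)
        - 2 / 3 * (⟪(y' y).1, (z' y).2⟫_ℝ + ⟪(z' y).1, (y' y).2⟫_ℝ) := by
      ext1 y; rw [g_one]
    rw [hh, HasFDerivAt.fderiv (f := fun y =>
      4 / 3 * (⟪(y' y).1, (z' y).1⟫_ℝ + ⟪(y' y).2, (z' y).2⟫_ℝ)
        - 2 / 3 * (⟪(y' y).1, (z' y).2⟫_ℝ + ⟪(z' y).1, (y' y).2⟫_ℝ)) h, g_one, g_one]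
    simp [real_inner_comm]
    ring
  rw [hD]
  simp only [g_one, Prod.fst_add, Prod.snd_add, inner_add_left, inner_add_right] at hm ⊢
  linear_combination -hm

end Along

/-- The tensor `G(X, Y) = (∇̃_X J) Y = ∇̃_X (J Y) - J ∇̃_X Y` at `z`, computed with the left-invariant
extension `w ↦ w z⁻¹ Y` of the tangent vector `Y`. -/
noncomputable def G (z X Y : HH) : HH :=
  nabla (fun w : HH => w) (fun w => J w (w * (z⁻¹ * Y))) z X
    - J z (nabla (fun w : HH => w) (fun w => w * (z⁻¹ * Y)) z X)

/-! ### Riemannian metrics in coordinates on `ℝⁿ` -/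

section Coordinates

variable {n : ℕ}

/-- The standard basis vector `e i` of `ℝⁿ`. -/
noncomputable def e (i : Fin n) : EuclideanSpace ℝ (Fin n) := EuclideanSpace.single i 1

/-- The vector that represents the linear form `α` with respect to the inner product `b`,
that is `∑ i j, bⁱʲ α(e j) e i`. -/
noncomputable def sharp (b : EuclideanSpace ℝ (Fin n) → EuclideanSpace ℝ (Fin n) → ℝ)
    (α : EuclideanSpace ℝ (Fin n) → ℝ) : EuclideanSpace ℝ (Fin n) :=
  ∑ i, ∑ j, ((Matrix.of fun k l => b (e k) (e l))⁻¹ i j * α (e j)) • e i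

/-- The Christoffel symbol `Γ_x(u, v) = ∇_u v` of a metric `b` on an open subset of `ℝⁿ`, for
constant vector fields `u`, `v`. -/
noncomputable def christoffel
    (b : EuclideanSpace ℝ (Fin n) → EuclideanSpace ℝ (Fin n) → EuclideanSpace ℝ (Fin n) → ℝ)
    (x u v : EuclideanSpace ℝ (Fin n)) : EuclideanSpace ℝ (Fin n) :=
  sharp (b x) fun w =>
    (1 / 2) * (fderiv ℝ (fun y => b y v w) x u + fderiv ℝ (fun y => b y u w) x v
      - fderiv ℝ (fun y => b y u v) x w)

/-- The curvature tensor `R(u, v) w = ∇_u ∇_v w - ∇_v ∇_u w - ∇_[u,v] w` of the metric `b` at `x`. -/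
noncomputable def curvature
    (b : EuclideanSpace ℝ (Fin n) → EuclideanSpace ℝ (Fin n) → EuclideanSpace ℝ (Fin n) → ℝ)
    (x u v w : EuclideanSpace ℝ (Fin n)) : EuclideanSpace ℝ (Fin n) :=
  fderiv ℝ (fun y => christoffel b y v w) x u - fderiv ℝ (fun y => christoffel b y u w) x v
    + christoffel b x u (christoffel b x v w) - christoffel b x v (christoffel b x u w)

/-- The sectional curvature of the plane spanned by `u` and `v`. -/
noncomputable def sectional
    (b : EuclideanSpace ℝ (Fin n) → EuclideanSpace ℝ (Fin n) → EuclideanSpace ℝ (Fin n) → ℝ)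
    (x u v : EuclideanSpace ℝ (Fin n)) : ℝ :=
  b x (curvature b x u v v) u / (b x u u * b x v v - b x u v ^ 2)

end Coordinates

/-! ### Lagrangian submanifolds -/

/-- `ℝ³`, the model space of a submanifold `M`. -/
abbrev E3 : Type := EuclideanSpace ℝ (Fin 3)

section Submanifold

variable {M : Type*} [TopologicalSpace M] [ChartedSpace E3 M]

/-- `f_*`, the differential of `f` at `m`, on `T_m M`. -/
noncomputable def push (f : M → HH) (m : M) (X : TangentSpace 𝓘(ℝ, E3) m) : HH :=
  mfderiv 𝓘(ℝ, E3) 𝓘(ℝ, HH) f m X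

/-- `f : M → S³ × S³` is a Lagrangian immersion of the `3`-manifold `M`: it is a smooth immersion
and `J` maps tangent vectors to normal vectors. -/
structure IsLagrangian (f : M → HH) : Prop where
  smooth : ContMDiff 𝓘(ℝ, E3) 𝓘(ℝ, HH) ∞ f
  mem : ∀ m, f m ∈ S3S3
  immersion : ∀ m, Function.Injective (push f m)
  lagrangian : ∀ m (X Y : TangentSpace 𝓘(ℝ, E3) m), g (f m) (J (f m) (push f m X)) (push f m Y) = 0

/-- The expression of `f` in the preferred chart of `M` at `m`.  Tangent vectors in `T_m M` are, in
Mathlib, the coordinate vectors with respect to this chart. -/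
noncomputable def inChart (f : M → HH) (m : M) : E3 → HH := f ∘ (extChartAt 𝓘(ℝ, E3) m).symm

/-- The induced metric `f^* g`, in the chart at `m`. -/
noncomputable def inducedMetric (f : M → HH) (m : M) (x u v : E3) : ℝ :=
  g (inChart f m x) (fderiv ℝ (inChart f m) x u) (fderiv ℝ (inChart f m) x v)

/-- `M` with the induced metric has constant sectional curvature. -/
def HasConstantSectionalCurvature (f : M → HH) : Prop :=
  ∃ c : ℝ, ∀ (m : M) (u v : E3), LinearIndependent ℝ ![u, v] →
    sectional (inducedMetric f m) (extChartAt 𝓘(ℝ, E3) m m) u v = c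

/-- The tangential part of the ambient vector `Z` at `f m`, as a vector in `T_m M`: the vector `t`
with `g(f_* t, f_* u) = g(Z, f_* u)` for all `u`. -/
noncomputable def tan (f : M → HH) (m : M) (Z : HH) : TangentSpace 𝓘(ℝ, E3) m :=
  sharp (n := 3) (fun u v => g (f m) (push f m u) (push f m v)) fun u => g (f m) Z (push f m u)

/-- The second fundamental form: `h(X, Y)` is the normal part of `∇̃_X (f_* Y)`, where `Y` is
extended to the vector field that is constant in the chart at `m`. -/
noncomputable def h (f : M → HH) (m : M) (X Y : TangentSpace 𝓘(ℝ, E3) m) : HH :=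
  let D : HH := nabla (inChart f m) (fun y : E3 => fderiv ℝ (inChart f m) y Y)
    (extChartAt 𝓘(ℝ, E3) m m) X
  D - push f m (tan f m D)

/-- The endomorphism `A` of `T_m M` with `P X = A X + J B X`: the tangential part of `P X`. -/
noncomputable def A (f : M → HH) (m : M) (X : TangentSpace 𝓘(ℝ, E3) m) :
    TangentSpace 𝓘(ℝ, E3) m :=
  tan f m (P (f m) (push f m X))

/-- The endomorphism `B` of `T_m M` with `P X = A X + J B X`: as `-J P X = B X - J A X`, it is the
tangential part of `-J P X`. -/
noncomputable def B (f : M → HH) (m : M) (X : TangentSpace 𝓘(ℝ, E3) m) :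
    TangentSpace 𝓘(ℝ, E3) m :=
  tan f m (-J (f m) (P (f m) (push f m X)))

/-- The summand `{ … }` of the cyclic sum, a vector in the ambient space at `f m`. -/
noncomputable def summand (f : M → HH) (m : M) (W X Y Z : TangentSpace 𝓘(ℝ, E3) m) : HH :=
  let ι := push f m
  let gm := g (f m)
  let Jm := J (f m)
  let Gm := fun U V : TangentSpace 𝓘(ℝ, E3) m => G (f m) (ι U) (ι V)
  let hm := h f m
  let a := A f m
  let b := B f m
  (gm (Jm (Gm Y W)) (ι (a Z)) + (1 / 2) * gm (Jm (Gm Y Z)) (ι (a W))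
      - (1 / 2) * gm (Jm (Gm W Z)) (ι (a Y))
      + gm (hm W Z) (Jm (ι (b Y))) - gm (hm Y Z) (Jm (ι (b W)))) • Jm (ι (b X))
  + (gm (Jm (Gm W Y)) (ι (b Z)) + (1 / 2) * gm (Jm (Gm W Z)) (ι (b Y))
      - (1 / 2) * gm (Jm (Gm Y Z)) (ι (b W))
      + gm (hm W Z) (Jm (ι (a Y))) - gm (hm Y Z) (Jm (ι (a W)))) • Jm (ι (a X))
  + gm (ι (a X)) (ι Z) •
      (Jm (ι (b (tan f m (Jm (Gm W Y))))) + (1 / 2 : ℝ) • Gm Y (b W) - (1 / 2 : ℝ) • Gm W (b Y)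
        + hm W (a Y) - hm Y (a W))
  + gm (ι (b X)) (ι Z) •
      (-Jm (ι (a (tan f m (Jm (Gm W Y))))) + (1 / 2 : ℝ) • Gm W (a Y) - (1 / 2 : ℝ) • Gm Y (a W)
        + hm W (b Y) - hm Y (b W))

end Submanifold

end NK

/-! All the structure is left invariant, so at a point the claim is linear algebra in Im ℍ ⊕ Im ℍ.
There the tangent space T of `M` is a Lagrangian 3-space, the Lie algebra is T ⊕ JT, and the data
become tensors on T: the self-adjoint maps `A`, `B`, which commute because P² = 1 and PJ = -JP,
together with S = JG and K = -Jh. The form g(S(u,v),w) is alternating, by the nearly Kähler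
condition; g(K(u,v),w) is totally symmetric, by the Lagrangian condition. Up to J, the cyclic sum is
a part linear in S plus a part linear in K, and each part vanishes.

The S part (`cyclic_sum_torsion`) vanishes on every Lagrangian subspace, because dim T = 3: a
self-adjoint map acts on 3-forms through its trace, and antisymmetrizing a 3-form times a 1-form
over four arguments gives zero.

The K part (`cyclic_sum_cubic`) uses constant curvature. By the formula for the ambient curvature
(`gForm_ambientCurv`) and the Gauss equation (`gauss_equation`), the expression A∧A + B∧B is a
multiple of the metric term minus 3 K∧K. Two instances of this relation, with one argument replaced
by a value of K, produce the K part, and their right-hand sides cancel under the cyclic sum. Only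
the Gauss equation at the point enters, not a derivative of it.

The geometric input is `lagrangian_symmetry`, the Gauss equation obtained from the Maurer-Cartan
form, and `ambientCurv_eq_of_sectional`, which recovers the whole curvature tensor from sectional
curvatures. -/

open scoped Topology

namespace NK

/-! ### Linear algebra of g, J, P, G and the ambient curvature on the Lie algebra. -/

/-- The metric at the identity as a bilinear form. -/
noncomputable def gForm : HH →ₗ[ℝ] HH →ₗ[ℝ] ℝ :=
  LinearMap.mk₂ ℝ (g 1)
    (fun u u' v => by
      simp only [g_one, Prod.fst_add, Prod.snd_add, inner_add_left, inner_add_right]; ring)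
    (fun c u v => by
      simp only [g_one, Prod.smul_fst, Prod.smul_snd, real_inner_smul_left, real_inner_smul_right,
        smul_eq_mul]; ring)
    (fun u v v' => by
      simp only [g_one, Prod.fst_add, Prod.snd_add, inner_add_left, inner_add_right]; ring)
    (fun c u v => by
      simp only [g_one, Prod.smul_fst, Prod.smul_snd, real_inner_smul_left, real_inner_smul_right,
        smul_eq_mul]; ring)

theorem gForm_apply (u v : HH) : gForm u v = g 1 u v := rfl

theorem gForm_comm (u v : HH) : gForm u v = gForm v u := by
  simp only [gForm_apply, g_one, real_inner_comm]; ring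

theorem gForm_self_pos {u : HH} (hu : u ≠ 0) : 0 < gForm u u := by
  have h1 : gForm u u = 2 / 3 * (‖u.1‖ ^ 2 + ‖u.2‖ ^ 2 + ‖u.1 - u.2‖ ^ 2) := by
    rw [gForm_apply, g_one, norm_sub_sq_real, real_inner_self_eq_norm_sq,
      real_inner_self_eq_norm_sq]
    ring
  rw [h1]
  have : 0 < ‖u.1‖ ^ 2 + ‖u.2‖ ^ 2 := by
    rcases not_and_or.1 (mt Prod.ext_iff.2 hu) with h | h
    · have := norm_pos_iff.2 h
      positivity
    · have := norm_pos_iff.2 h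
      positivity
  positivity

/-- The almost complex structure at the identity. -/
noncomputable def Jₗ : HH →ₗ[ℝ] HH where
  toFun := J 1
  map_add' u v := by ext <;> simp [J] <;> ring
  map_smul' c u := by ext <;> simp [J] <;> ring

theorem Jₗ_apply (u : HH) : Jₗ u = J 1 u := rfl

/-- The almost product structure at the identity. -/
noncomputable def Pₗ : HH →ₗ[ℝ] HH where
  toFun := P 1
  map_add' u v := by ext <;> simp [P]
  map_smul' c u := by ext <;> simp [P]

theorem Pₗ_apply (u : HH) : Pₗ u = P 1 u := rfl

theorem Pₗ_eq (u : HH) : Pₗ u = (u.2, u.1) := by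
  ext <;> simp [Pₗ_apply, P]

/-- `√3` times the almost complex structure at the identity. -/
noncomputable def sqrtThreeJ (u : HH) : HH := ((2 : ℝ) • u.2 - u.1, (-2 : ℝ) • u.1 + u.2)

/-- Isolates √3 as a scalar factor, so that coordinate computations have rational coefficients and
are within reach of `ring`. -/
theorem Jₗ_eq (u : HH) : Jₗ u = (√3)⁻¹ • sqrtThreeJ u := by
  simp [Jₗ_apply, J, sqrtThreeJ]

theorem sqrt_three_inv_mul_self : (√3)⁻¹ * (√3)⁻¹ = (1 / 3 : ℝ) := by
  rw [← mul_inv, Real.mul_self_sqrt (by norm_num)]; norm_num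

theorem Jₗ_Jₗ (u : HH) : Jₗ (Jₗ u) = -u := by
  have h : sqrtThreeJ (sqrtThreeJ u) = (-3 : ℝ) • u := by
    ext <;> simp [sqrtThreeJ] <;> ring
  have hs : ∀ (c : ℝ) v, Jₗ (c • v) = c • Jₗ v := fun c v => Jₗ.map_smul c v
  rw [Jₗ_eq u, hs, Jₗ_eq, smul_smul, sqrt_three_inv_mul_self, h, smul_smul]
  norm_num

theorem gForm_Jₗ_left (u v : HH) : gForm (Jₗ u) v = -gForm u (Jₗ v) := by
  rw [Jₗ_eq, Jₗ_eq, map_smul, map_smul, LinearMap.smul_apply, smul_eq_mul, smul_eq_mul,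
    ← mul_neg]
  congr 1
  simp only [gForm_apply, g_one, Quaternion.inner_def]
  simp [sqrtThreeJ]
  ring

theorem gForm_Jₗ_Jₗ (u v : HH) : gForm (Jₗ u) (Jₗ v) = gForm u v := by
  rw [gForm_Jₗ_left, Jₗ_Jₗ, map_neg, neg_neg]

theorem Pₗ_Pₗ (u : HH) : Pₗ (Pₗ u) = u := by simp [Pₗ_eq]

theorem Pₗ_Jₗ (u : HH) : Pₗ (Jₗ u) = -Jₗ (Pₗ u) := by
  simp only [Jₗ_eq, Pₗ_eq, map_smul]
  ext <;> simp [sqrtThreeJ] <;> ring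

theorem gForm_Pₗ_left (u v : HH) : gForm (Pₗ u) v = gForm u (Pₗ v) := by
  simp only [gForm_apply, g_one, Pₗ_eq, real_inner_comm]
  ring

theorem inner_coords (a b : ℍ[ℝ]) :
    ⟪a, b⟫_ℝ = a.re * b.re + a.imI * b.imI + a.imJ * b.imJ + a.imK * b.imK := by
  rw [Quaternion.inner_def]
  simp

theorem lie_re (a b : ℍ[ℝ]) : (⁅a, b⁆).re = 0 := by
  simp [Ring.lie_def]; ring

theorem lie_imI (a b : ℍ[ℝ]) : (⁅a, b⁆).imI = 2 * (a.imJ * b.imK - a.imK * b.imJ) := by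
  simp [Ring.lie_def]; ring

theorem lie_imJ (a b : ℍ[ℝ]) : (⁅a, b⁆).imJ = 2 * (a.imK * b.imI - a.imI * b.imK) := by
  simp [Ring.lie_def]; ring

theorem lie_imK (a b : ℍ[ℝ]) : (⁅a, b⁆).imK = 2 * (a.imI * b.imJ - a.imJ * b.imI) := by
  simp [Ring.lie_def]; ring

/-- The Levi-Civita product as a bilinear map. -/
noncomputable def lcₗ : HH →ₗ[ℝ] HH →ₗ[ℝ] HH :=
  LinearMap.mk₂ ℝ lcProd
    (fun u u' v => by
      ext <;> simp [lcProd, lie_re, lie_imI, lie_imJ, lie_imK] <;> ring)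
    (fun c u v => by
      ext <;> simp [lcProd, lie_re, lie_imI, lie_imJ, lie_imK] <;> ring)
    (fun u v v' => by
      ext <;> simp [lcProd, lie_re, lie_imI, lie_imJ, lie_imK] <;> ring)
    (fun c u v => by
      ext <;> simp [lcProd, lie_re, lie_imI, lie_imJ, lie_imK] <;> ring)

theorem lcₗ_apply (u v : HH) : lcₗ u v = lcProd u v := rfl

/-- The subspace `Im ℍ ⊕ Im ℍ`, the Lie algebra of `S³ × S³`. -/
def imag : Submodule ℝ HH where
  carrier := {u | u.1.re = 0 ∧ u.2.re = 0}
  add_mem' := by rintro u v ⟨h1, h2⟩ ⟨h3, h4⟩; simp [h1, h2, h3, h4]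
  zero_mem' := by simp
  smul_mem' := by rintro c u ⟨h1, h2⟩; simp [h1, h2]

theorem mem_imag {u : HH} : u ∈ imag ↔ u.1.re = 0 ∧ u.2.re = 0 := Iff.rfl

theorem Jₗ_mem {u : HH} (hu : u ∈ imag) : Jₗ u ∈ imag := by
  obtain ⟨h1, h2⟩ := hu
  simp [mem_imag, Jₗ_eq, sqrtThreeJ, h1, h2]

theorem Pₗ_mem {u : HH} (hu : u ∈ imag) : Pₗ u ∈ imag := by
  obtain ⟨h1, h2⟩ := hu
  simp [mem_imag, Pₗ_eq, h1, h2]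

theorem lcₗ_mem (u v : HH) : lcₗ u v ∈ imag := by
  simp [mem_imag, lcₗ_apply, lcProd, lie_re]

/-- The tensor `G = ∇̃ J` at the identity. -/
noncomputable def Gₗ : HH →ₗ[ℝ] HH →ₗ[ℝ] HH :=
  lcₗ.compl₂ Jₗ - lcₗ.compr₂ Jₗ

theorem Gₗ_apply (u v : HH) : Gₗ u v = lcₗ u (Jₗ v) - Jₗ (lcₗ u v) := rfl

theorem Gₗ_mem (u v : HH) : Gₗ u v ∈ imag := by
  rw [Gₗ_apply]
  exact imag.sub_mem (lcₗ_mem u _) (Jₗ_mem (lcₗ_mem u v))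

/-- `√3 G` at the identity. -/
noncomputable def sqrtThreeG (u v : HH) : HH :=
  lcProd u (sqrtThreeJ v) - sqrtThreeJ (lcProd u v)

theorem Gₗ_eq (u v : HH) : Gₗ u v = (√3)⁻¹ • sqrtThreeG u v := by
  rw [Gₗ_apply, Jₗ_eq v, Jₗ_eq (lcₗ u v), map_smul (lcₗ u), ← smul_sub, lcₗ_apply, lcₗ_apply,
    sqrtThreeG]

/-- This is the nearly Kähler condition (∇̃_u J) u = 0 in polarized form. -/
theorem Gₗ_swap (u v : HH) : Gₗ u v = -Gₗ v u := by
  rw [Gₗ_eq, Gₗ_eq, ← smul_neg]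
  congr 1
  ext <;> simp only [sqrtThreeG, sqrtThreeJ, lcProd, Prod.fst_neg, Prod.snd_neg,
    Quaternion.re_neg, Quaternion.imI_neg, Quaternion.imJ_neg, Quaternion.imK_neg,
    lie_re, lie_imI, lie_imJ, lie_imK, Prod.fst_sub, Prod.snd_sub,
    Quaternion.re_add, Quaternion.imI_add, Quaternion.imJ_add, Quaternion.imK_add,
    Quaternion.re_sub, Quaternion.imI_sub, Quaternion.imJ_sub, Quaternion.imK_sub,
    Quaternion.re_smul, Quaternion.imI_smul, Quaternion.imJ_smul, Quaternion.imK_smul,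
    smul_eq_mul] <;> ring

theorem gForm_Gₗ_swap (u v w : HH) : gForm (Gₗ u v) w = -gForm (Gₗ u w) v := by
  rw [Gₗ_eq, Gₗ_eq, map_smul, map_smul, LinearMap.smul_apply, LinearMap.smul_apply, ← smul_neg]
  congr 1
  simp only [gForm_apply, g_one, inner_coords, sqrtThreeG, sqrtThreeJ, lcProd,
    lie_re, lie_imI, lie_imJ, lie_imK, Prod.fst_sub, Prod.snd_sub,
    Quaternion.re_add, Quaternion.imI_add, Quaternion.imJ_add, Quaternion.imK_add,
    Quaternion.re_sub, Quaternion.imI_sub, Quaternion.imJ_sub, Quaternion.imK_sub,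
    Quaternion.re_smul, Quaternion.imI_smul, Quaternion.imJ_smul, Quaternion.imK_smul,
    smul_eq_mul]
  ring

/-- Conceptually, J and ∇̃_u J are skew and anticommute, so their composite is skew. With `Gₗ_swap`
this makes g(JG(u,v),w) a 3-form. -/
theorem gForm_Jₗ_Gₗ_swap (u v w : HH) : gForm (Jₗ (Gₗ u v)) w = -gForm (Jₗ (Gₗ u w)) v := by
  rw [gForm_Jₗ_left, gForm_Jₗ_left]
  congr 1
  rw [Gₗ_eq, Gₗ_eq, Jₗ_eq, Jₗ_eq]
  simp only [map_smul, LinearMap.smul_apply, ← smul_neg]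
  congr 2
  simp only [gForm_apply, g_one, inner_coords, sqrtThreeG, sqrtThreeJ, lcProd,
    lie_re, lie_imI, lie_imJ, lie_imK, Prod.fst_sub, Prod.snd_sub,
    Quaternion.re_add, Quaternion.imI_add, Quaternion.imJ_add, Quaternion.imK_add,
    Quaternion.re_sub, Quaternion.imI_sub, Quaternion.imJ_sub, Quaternion.imK_sub,
    Quaternion.re_smul, Quaternion.imI_smul, Quaternion.imJ_smul, Quaternion.imK_smul,
    smul_eq_mul]
  ring

/-- The curvature tensor of `S³ × S³` at the identity. -/
noncomputable def ambientCurv (a b c : HH) : HH :=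
  lcₗ a (lcₗ b c) - lcₗ b (lcₗ a c) - lcₗ (a * b - b * a) c

-- The curvature formula with √3 cleared: 1/36 = 1/12 · 1/3 and 1/9 = 1/3 · 1/3. The brackets ignore
-- real parts but the metric does not, hence the restriction to `imag`.
set_option maxHeartbeats 4000000 in
theorem gForm_ambientCurv_aux {a b c d : HH} (ha : a ∈ imag) (hb : b ∈ imag) (hc : c ∈ imag)
    (hd : d ∈ imag) : gForm (ambientCurv a b c) d =
      5 / 12 * (gForm b c * gForm a d - gForm a c * gForm b d)
      + 1 / 36 * (gForm (sqrtThreeJ b) c * gForm (sqrtThreeJ a) d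
          - gForm (sqrtThreeJ a) c * gForm (sqrtThreeJ b) d
          - 2 * gForm (sqrtThreeJ a) b * gForm (sqrtThreeJ c) d)
      + 1 / 3 * (gForm (Pₗ b) c * gForm (Pₗ a) d - gForm (Pₗ a) c * gForm (Pₗ b) d)
      + 1 / 9 * (gForm (sqrtThreeJ (Pₗ b)) c * gForm (sqrtThreeJ (Pₗ a)) d
          - gForm (sqrtThreeJ (Pₗ a)) c * gForm (sqrtThreeJ (Pₗ b)) d) := by
  obtain ⟨ha, ha'⟩ := ha
  obtain ⟨hb, hb'⟩ := hb
  obtain ⟨hc, hc'⟩ := hc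
  obtain ⟨hd, hd'⟩ := hd
  have hab : a * b - b * a = (⁅a.1, b.1⁆, ⁅a.2, b.2⁆) := rfl
  simp only [gForm_apply, g_one, inner_coords, Pₗ_eq, ambientCurv, lcₗ_apply, hab, sqrtThreeJ,
    lcProd, lie_re, lie_imI, lie_imJ, lie_imK, Prod.fst_sub, Prod.snd_sub,
    Quaternion.re_add, Quaternion.imI_add, Quaternion.imJ_add, Quaternion.imK_add,
    Quaternion.re_sub, Quaternion.imI_sub, Quaternion.imJ_sub, Quaternion.imK_sub,
    Quaternion.re_smul, Quaternion.imI_smul, Quaternion.imJ_smul, Quaternion.imK_smul,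
    smul_eq_mul, ha, ha', hb, hb', hc, hc', hd, hd']
  ring

/-- On a Lagrangian subspace the terms with coefficient 1/12 vanish, and the P and JP terms become
products of `A` and of `B`. -/
theorem gForm_ambientCurv {a b c d : HH} (ha : a ∈ imag) (hb : b ∈ imag) (hc : c ∈ imag)
    (hd : d ∈ imag) : gForm (ambientCurv a b c) d =
      5 / 12 * (gForm b c * gForm a d - gForm a c * gForm b d)
      + 1 / 12 * (gForm (Jₗ b) c * gForm (Jₗ a) d - gForm (Jₗ a) c * gForm (Jₗ b) d
          - 2 * gForm (Jₗ a) b * gForm (Jₗ c) d)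
      + 1 / 3 * (gForm (Pₗ b) c * gForm (Pₗ a) d - gForm (Pₗ a) c * gForm (Pₗ b) d
          + gForm (Jₗ (Pₗ b)) c * gForm (Jₗ (Pₗ a)) d
          - gForm (Jₗ (Pₗ a)) c * gForm (Jₗ (Pₗ b)) d) := by
  rw [gForm_ambientCurv_aux ha hb hc hd]
  simp only [Jₗ_eq, map_smul, LinearMap.smul_apply, smul_eq_mul]
  linear_combination -sqrt_three_inv_mul_self *
    (1 / 12 * (gForm (sqrtThreeJ b) c * gForm (sqrtThreeJ a) d
          - gForm (sqrtThreeJ a) c * gForm (sqrtThreeJ b) d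
          - 2 * gForm (sqrtThreeJ a) b * gForm (sqrtThreeJ c) d)
      + 1 / 3 * (gForm (sqrtThreeJ (Pₗ b)) c * gForm (sqrtThreeJ (Pₗ a)) d
          - gForm (sqrtThreeJ (Pₗ a)) c * gForm (sqrtThreeJ (Pₗ b)) d))


/-! ### Representing linear forms through the Gram matrix. -/

section Sharp

variable {n : ℕ}

local notation "En" => EuclideanSpace ℝ (Fin n)

theorem eq_sum_e (u : En) : u = ∑ i, u i • e i := by
  ext j
  simp [e, Pi.single_apply]

/-- A kernel vector of the Gram matrix is orthogonal to the basis, hence to itself. -/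
theorem gram_det_ne_zero {β : En →ₗ[ℝ] En →ₗ[ℝ] ℝ} (hpos : ∀ u, u ≠ 0 → 0 < β u u) :
    (Matrix.of fun k l => β (e k) (e l)).det ≠ 0 := by
  intro h0
  obtain ⟨v, hv, hv0⟩ := Matrix.exists_mulVec_eq_zero_iff.2 h0
  have hne : (WithLp.toLp 2 v : En) ≠ 0 := by
    intro h
    exact hv (by simpa using congrArg WithLp.ofLp h)
  refine (hpos _ hne).ne' ?_
  have hs := eq_sum_e (WithLp.toLp 2 v : En)
  have hk : ∀ k, β (e k) (WithLp.toLp 2 v : En) = 0 := by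
    intro k
    rw [hs, map_sum]
    have := congrFun hv0 k
    simp only [Matrix.mulVec, dotProduct, Matrix.of_apply, Pi.zero_apply] at this
    rw [← this]
    refine Finset.sum_congr rfl fun l _ => ?_
    rw [map_smul, smul_eq_mul, mul_comm]
  have ht : ∀ t, β t (WithLp.toLp 2 v : En) = 0 := by
    intro t
    rw [eq_sum_e t, map_sum, LinearMap.sum_apply]
    simp [hk]
  exact ht _

theorem sharp_spec {β : En →ₗ[ℝ] En →ₗ[ℝ] ℝ} (hsymm : ∀ u v, β u v = β v u)
    (hpos : ∀ u, u ≠ 0 → 0 < β u u) (α : En →ₗ[ℝ] ℝ) (w : En) :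
    β (sharp (fun u v => β u v) α) w = α w := by
  have hdet : IsUnit (Matrix.of fun k l => β (e k) (e l)).det := (gram_det_ne_zero hpos).isUnit
  set N := Matrix.of fun k l => β (e k) (e l) with hN
  have hNt : N.transpose = N := by
    ext i j; simp [hN, hsymm (e j)]
  have hit : N⁻¹.transpose = N⁻¹ := by rw [Matrix.transpose_nonsing_inv, hNt]
  have key : ∀ k, β (sharp (fun u v => β u v) α) (e k) = α (e k) := by
    intro k
    have h1 : ∀ j, ∑ i, N⁻¹ i j * N i k = if j = k then 1 else 0 := by
      intro j
      have := congrFun (congrFun (Matrix.nonsing_inv_mul N hdet) j) k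
      rw [Matrix.mul_apply, Matrix.one_apply] at this
      rw [← this]
      refine Finset.sum_congr rfl fun i _ => ?_
      rw [← Matrix.transpose_apply N⁻¹ j i, hit]
    simp only [sharp, map_sum, map_smul, LinearMap.sum_apply, LinearMap.smul_apply, smul_eq_mul]
    rw [Finset.sum_comm]
    calc _ = ∑ j, α (e j) * ∑ i, N⁻¹ i j * N i k := by
          refine Finset.sum_congr rfl fun j _ => ?_
          rw [Finset.mul_sum]
          refine Finset.sum_congr rfl fun i _ => ?_
          rw [← hN]
          simp only [hN, Matrix.of_apply]
          ring
      _ = _ := by simp [h1]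
  rw [eq_sum_e w, map_sum, map_sum]
  simp [key]

end Sharp

/-! ### Algebra of the tangent space -/

/-- The 3-forms on ℝ³ are the multiples of the determinant. -/
theorem alternating_eq_det {η : E3 →ₗ[ℝ] E3 →ₗ[ℝ] E3 →ₗ[ℝ] ℝ} (h1 : ∀ u v w, η u v w = -η v u w)
    (h2 : ∀ u v w, η u v w = -η u w v) : ∃ κ : ℝ, ∀ u v w, η u v w =
      κ * (u 0 * (v 1 * w 2 - v 2 * w 1) - u 1 * (v 0 * w 2 - v 2 * w 0)
        + u 2 * (v 0 * w 1 - v 1 * w 0)) := by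
  refine ⟨η (e 0) (e 1) (e 2), fun u v w => ?_⟩
  have z1 : ∀ u w, η u u w = 0 := fun u w => by linarith [h1 u u w]
  have z2 : ∀ u w, η u w w = 0 := fun u w => by linarith [h2 u w w]
  have z3 : ∀ u w, η u w u = 0 := fun u w => by rw [h1, z2, neg_zero]
  have e1 := h2 (e 0) (e 2) (e 1)
  have e2 := h1 (e 1) (e 0) (e 2)
  have e3 : η (e 1) (e 2) (e 0) = η (e 0) (e 1) (e 2) := by rw [h2, h1]; ring
  have e4 : η (e 2) (e 0) (e 1) = η (e 0) (e 1) (e 2) := by rw [h1, h2]; ring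
  have e5 : η (e 2) (e 1) (e 0) = -η (e 0) (e 1) (e 2) := by rw [h1, e3]
  conv_lhs => rw [eq_sum_e u, eq_sum_e v, eq_sum_e w]
  simp only [Fin.sum_univ_three, map_add, map_smul, LinearMap.add_apply, LinearMap.smul_apply,
    smul_eq_mul, z1, z2, z3, e1, e2, e3, e4, e5]
  ring

/-- An endomorphism acts as a derivation on the line of 3-forms, and the scalar is its trace. -/
theorem alternating_trace {η : E3 →ₗ[ℝ] E3 →ₗ[ℝ] E3 →ₗ[ℝ] ℝ} (h1 : ∀ u v w, η u v w = -η v u w)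
    (h2 : ∀ u v w, η u v w = -η u w v) (A : E3 →ₗ[ℝ] E3) : ∃ τ : ℝ, ∀ u v w,
      η (A u) v w + η u (A v) w + η u v (A w) = τ * η u v w := by
  obtain ⟨κ, hκ⟩ := alternating_eq_det h1 h2
  refine ⟨A (e 0) 0 + A (e 1) 1 + A (e 2) 2, fun u v w => ?_⟩
  have hA : ∀ (u : E3) (i : Fin 3), A u i =
      u 0 * A (e 0) i + u 1 * A (e 1) i + u 2 * A (e 2) i := by
    intro u i
    conv_lhs => rw [eq_sum_e u]
    simp [Fin.sum_univ_three]
  simp only [hκ, hA u, hA v, hA w]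
  ring

/-- The wedge of η and φ is a 4-form on a 3-dimensional space, so it is zero. -/
theorem alternating_cyclic {η : E3 →ₗ[ℝ] E3 →ₗ[ℝ] E3 →ₗ[ℝ] ℝ} (h1 : ∀ u v w, η u v w = -η v u w)
    (h2 : ∀ u v w, η u v w = -η u w v) (φ : E3 →ₗ[ℝ] ℝ) (w x y p : E3) :
    η w y p * φ x + η x w p * φ y + η y x p * φ w = -(η w x y * φ p) := by
  obtain ⟨κ, hκ⟩ := alternating_eq_det h1 h2
  have hφ : ∀ u : E3, φ u = u 0 * φ (e 0) + u 1 * φ (e 1) + u 2 * φ (e 2) := by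
    intro u
    conv_lhs => rw [eq_sum_e u]
    simp [Fin.sum_univ_three]
  simp only [hκ, hφ w, hφ x, hφ y, hφ p]
  ring


/-- The summand of the cyclic sum as a tangent vector, before applying `J`: here `J G` and the
second fundamental form `h` are represented by `S` and `K`, with `J G = S` and `h = J K`. -/
noncomputable def tangentSummand (b : E3 →ₗ[ℝ] E3 →ₗ[ℝ] ℝ) (A B : E3 →ₗ[ℝ] E3)
    (S K : E3 →ₗ[ℝ] E3 →ₗ[ℝ] E3) (w x y z : E3) : E3 :=
  (b (S y w) (A z) + (1 / 2) * b (S y z) (A w) - (1 / 2) * b (S w z) (A y)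
      + b (K w z) (B y) - b (K y z) (B w)) • B x
  + (b (S w y) (B z) + (1 / 2) * b (S w z) (B y) - (1 / 2) * b (S y z) (B w)
      + b (K w z) (A y) - b (K y z) (A w)) • A x
  + b (A x) z • (B (S w y) - (1 / 2 : ℝ) • S y (B w) + (1 / 2 : ℝ) • S w (B y)
      + K w (A y) - K y (A w))
  + b (B x) z • (-A (S w y) - (1 / 2 : ℝ) • S w (A y) + (1 / 2 : ℝ) • S y (A w)
      + K w (B y) - K y (B w))

section

variable {b : E3 →ₗ[ℝ] E3 →ₗ[ℝ] ℝ} {A B : E3 →ₗ[ℝ] E3} {S K : E3 →ₗ[ℝ] E3 →ₗ[ℝ] E3}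

/-- The trace identity leaves only products of b(S(w,y),·) with a linear form in x. By
`alternating_cyclic` each cyclic sum is then -b(S(w,x),y) times a scalar depending on z and t, and
these scalars cancel because `A` and `B` are self-adjoint and commute. -/
theorem cyclic_sum_torsion (hs : ∀ u v, b u v = b v u)
    (hA : ∀ u v, b (A u) v = b u (A v)) (hB : ∀ u v, b (B u) v = b u (B v))
    (hAB : ∀ u, A (B u) = B (A u))
    (hS1 : ∀ u v w, b (S u v) w = -b (S v u) w) (hS2 : ∀ u v w, b (S u v) w = -b (S u w) v)
    (w x y z t : E3) : b (tangentSummand b A B S 0 w x y z + tangentSummand b A B S 0 x y w z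
      + tangentSummand b A B S 0 y w x z) t = 0 := by
  obtain ⟨τ, hτ⟩ := alternating_trace (η := S.compr₂ b) hS1 hS2 A
  obtain ⟨σ, hσ⟩ := alternating_trace (η := S.compr₂ b) hS1 hS2 B
  have hc := fun p q => alternating_cyclic (η := S.compr₂ b) hS1 hS2 (b.flip q) w x y p
  simp only [LinearMap.compr₂_apply, LinearMap.flip_apply] at hτ hσ hc
  -- In `e1` to `e4` the traces τ and σ absorb the terms in which `A` or `B` acts on w or y.
  have e1 : ∀ w y z, b (S y w) (A z) + (1 / 2) * b (S y z) (A w) - (1 / 2) * b (S w z) (A y)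
      = (1 / 2) * τ * b (S w y) z - 3 / 2 * b (S w y) (A z) := fun w y z => by
    linear_combination (1 / 2) * hτ w y z + hS1 y w (A z) + (1 / 2) * hS2 y z (A w)
      - (1 / 2) * hS1 y (A w) z - (1 / 2) * hS2 w z (A y)
  have e2 : ∀ w y z, b (S w y) (B z) + (1 / 2) * b (S w z) (B y) - (1 / 2) * b (S y z) (B w)
      = 3 / 2 * b (S w y) (B z) - (1 / 2) * σ * b (S w y) z := fun w y z => by
    linear_combination -(1 / 2) * hσ w y z - (1 / 2) * hS2 y z (B w)
      + (1 / 2) * hS1 y (B w) z + (1 / 2) * hS2 w z (B y)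
  have e3 : ∀ w y t, b (B (S w y)) t - (1 / 2) * b (S y (B w)) t + (1 / 2) * b (S w (B y)) t
      = (1 / 2) * b (S w y) (B t) + (1 / 2) * σ * b (S w y) t := fun w y t => by
    linear_combination (1 / 2) * hσ w y t - (1 / 2) * hS1 y (B w) t + hB (S w y) t
  have e4 : ∀ w y t, -b (A (S w y)) t - (1 / 2) * b (S w (A y)) t + (1 / 2) * b (S y (A w)) t
      = -(1 / 2) * b (S w y) (A t) - (1 / 2) * τ * b (S w y) t := fun w y t => by
    linear_combination -(1 / 2) * hτ w y t + (1 / 2) * hS1 y (A w) t - hA (S w y) t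
  have hT : ∀ w x y, b (tangentSummand b A B S 0 w x y z) t =
      ((1 / 2) * τ * b (S w y) z - 3 / 2 * b (S w y) (A z)) * b x (B t)
      + (3 / 2 * b (S w y) (B z) - (1 / 2) * σ * b (S w y) z) * b x (A t)
      + b x (A z) * ((1 / 2) * b (S w y) (B t) + (1 / 2) * σ * b (S w y) t)
      + b x (B z) * (-(1 / 2) * b (S w y) (A t) - (1 / 2) * τ * b (S w y) t) := fun w x y => by
    simp only [tangentSummand, map_add, map_sub, map_neg, map_smul, LinearMap.add_apply,
      LinearMap.sub_apply, LinearMap.neg_apply, LinearMap.smul_apply, smul_eq_mul,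
      LinearMap.zero_apply, map_zero, add_zero, sub_zero, e1, e2, e3, e4, ← hA x, ← hB x]
  simp only [map_add, LinearMap.add_apply, hT]
  have f1 : b t (A z) = b z (A t) := by rw [hs, hA]
  have f2 : b t (B z) = b z (B t) := by rw [hs, hB]
  have f3 : b (B t) (A z) = b (A z) (B t) := hs _ _
  have f4 : b (A t) (B z) = b (A z) (B t) := by rw [hs, hB, hA, hAB]
  have f5 : b (B z) (A t) = b (A z) (B t) := by rw [hB, hA, hAB]
  have c1 := hc z (B t)
  have c2 := hc (A z) (B t)
  have c3 := hc (B z) (A t)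
  have c4 := hc z (A t)
  have c5 := hc (B t) (A z)
  have c6 := hc t (A z)
  have c7 := hc (A t) (B z)
  have c8 := hc t (B z)
  rw [f1] at c6
  rw [f2] at c8
  rw [f3] at c5
  rw [f4] at c7
  rw [f5] at c3
  linear_combination (1 / 2) * τ * c1 - 3 / 2 * c2 + 3 / 2 * c3 - (1 / 2) * σ * c4 + (1 / 2) * c5
    + (1 / 2) * σ * c6 - (1 / 2) * c7 - (1 / 2) * τ * c8

/-- The four terms pair off as `hQ` contracted with K: once with K(x,t) in the last slot, once with
K(x,z) in the third. -/
theorem cyclic_sum_cubic {k : ℝ} (hs : ∀ u v, b u v = b v u)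
    (hK1 : ∀ u v, K u v = K v u) (hK2 : ∀ u v w, b (K u v) w = b (K u w) v)
    (hQ : ∀ u v p q, b (A v) p * b (A u) q - b (A u) p * b (A v) q
        + (b (B v) p * b (B u) q - b (B u) p * b (B v) q) =
      k * (b v p * b u q - b u p * b v q)
        - 3 * (b (K v p) (K u q) - b (K u p) (K v q)))
    (w x y z t : E3) : b (tangentSummand b A B 0 K w x y z + tangentSummand b A B 0 K x y w z
      + tangentSummand b A B 0 K y w x z) t = 0 := by
  have hT : ∀ w x y, b (tangentSummand b A B 0 K w x y z) t =
      (b (K w z) (B y) - b (K y z) (B w)) * b (B x) t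
      + (b (K w z) (A y) - b (K y z) (A w)) * b (A x) t
      + b (A x) z * (b (K w t) (A y) - b (K y t) (A w))
      + b (B x) z * (b (K w t) (B y) - b (K y t) (B w)) := fun w x y => by
    simp only [tangentSummand, map_add, map_sub, map_smul, LinearMap.add_apply,
      LinearMap.sub_apply, LinearMap.smul_apply, smul_eq_mul,
      LinearMap.zero_apply, map_zero, add_zero, sub_zero, mul_zero, zero_add, neg_zero, smul_zero,
      hK2 _ _ t]
  simp only [map_add, LinearMap.add_apply, hT]
  have q : ∀ w x y, (b (A y) z * b (K x t) (A w) - b (A w) z * b (K x t) (A y)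
        + (b (B y) z * b (K x t) (B w) - b (B w) z * b (K x t) (B y)))
      - (b (A w) t * b (K x z) (A y) - b (A y) t * b (K x z) (A w)
        + (b (B w) t * b (K x z) (B y) - b (B y) t * b (K x z) (B w))) =
      k * (b y z * b (K x w) t - b w z * b (K x y) t - b (K x y) z * b w t + b (K x w) z * b y t)
        - 3 * (b (K y z) (K w (K x t)) - b (K w z) (K y (K x t))
          - b (K x z) (K y (K w t)) + b (K x z) (K w (K y t))) := by
    intro w x y
    have h1 := hQ w y z (K x t)
    have h2 := hQ w y (K x z) t
    rw [hs (A w) (K x t), hs (A y) (K x t), hs (B w) (K x t), hs (B y) (K x t), hs w (K x t),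
      hs y (K x t), hK2 x t w, hK2 x t y] at h1
    rw [hs (A w) (K x z), hs (A y) (K x z), hs (B w) (K x z), hs (B y) (K x z), hs w (K x z),
      hs y (K x z), hK2 x z w, hK2 x z y, hK2 y (K x z), hs (K y (K w t)), hK2 w (K x z),
      hs (K w (K y t))] at h2
    linear_combination h1 - h2
  have q1 := q w x y
  have q2 := q x y w
  have q3 := q y w x
  rw [hK1 x y, hK1 x w] at q1
  rw [hK1 y w] at q2
  linear_combination q1 + q2 + q3

theorem cyclic_sum_tangentSummand {k : ℝ} (hs : ∀ u v, b u v = b v u)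
    (hpos : ∀ u, u ≠ 0 → 0 < b u u)
    (hA : ∀ u v, b (A u) v = b u (A v)) (hB : ∀ u v, b (B u) v = b u (B v))
    (hAB : ∀ u, A (B u) = B (A u))
    (hS1 : ∀ u v w, b (S u v) w = -b (S v u) w) (hS2 : ∀ u v w, b (S u v) w = -b (S u w) v)
    (hK1 : ∀ u v, K u v = K v u) (hK2 : ∀ u v w, b (K u v) w = b (K u w) v)
    (hQ : ∀ u v p q, b (A v) p * b (A u) q - b (A u) p * b (A v) q
        + (b (B v) p * b (B u) q - b (B u) p * b (B v) q) =
      k * (b v p * b u q - b u p * b v q)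
        - 3 * (b (K v p) (K u q) - b (K u p) (K v q)))
    (w x y z : E3) : tangentSummand b A B S K w x y z + tangentSummand b A B S K x y w z
      + tangentSummand b A B S K y w x z = 0 := by
  have hsplit : ∀ w x y, tangentSummand b A B S K w x y z =
      tangentSummand b A B S 0 w x y z + tangentSummand b A B 0 K w x y z := fun w x y => by
    simp only [tangentSummand, LinearMap.zero_apply, map_zero, add_zero, sub_zero, mul_zero,
      zero_add, neg_zero, smul_zero]
    module
  by_contra hne
  -- The two vanishing results are paired with an arbitrary t; taking t to be the sum itself
  -- contradicts positivity.
  refine (hpos _ hne).ne' ?_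
  have h1 := fun t => cyclic_sum_torsion hs hA hB hAB hS1 hS2 w x y z t
  have h2 := fun t => cyclic_sum_cubic hs hK1 hK2 hQ w x y z t
  generalize hV : tangentSummand b A B S K w x y z + tangentSummand b A B S K x y w z
      + tangentSummand b A B S K y w x z = V
  have hsum := congrArg₂ (· + ·) (h1 V) (h2 V)
  simp only [← LinearMap.add_apply, ← map_add, add_zero] at hsum
  convert hsum using 3
  rw [← hV]
  simp only [hsplit]
  abel

end

/-! ### Left translation to the identity. -/

/-- The tangential part of `Z`, for the tangent space parametrized by `ι`. -/
noncomputable def tanOf (z : HH) (ι : E3 → HH) (Z : HH) : E3 :=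
  sharp (fun u v => g z (ι u) (ι v)) fun u => g z Z (ι u)

/-- The summand of the cyclic sum, for the tangent space parametrized by `ι` and the second
fundamental form `H`. -/
noncomputable def summandOf (z : HH) (ι : E3 → HH) (H : E3 → E3 → HH) (W X Y Z : E3) : HH :=
  let gm := g z
  let Jm := J z
  let Gm := fun U V : E3 => G z (ι U) (ι V)
  let a := fun X => tanOf z ι (P z (ι X))
  let b := fun X => tanOf z ι (-J z (P z (ι X)))
  (gm (Jm (Gm Y W)) (ι (a Z)) + (1 / 2) * gm (Jm (Gm Y Z)) (ι (a W))
      - (1 / 2) * gm (Jm (Gm W Z)) (ι (a Y))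
      + gm (H W Z) (Jm (ι (b Y))) - gm (H Y Z) (Jm (ι (b W)))) • Jm (ι (b X))
  + (gm (Jm (Gm W Y)) (ι (b Z)) + (1 / 2) * gm (Jm (Gm W Z)) (ι (b Y))
      - (1 / 2) * gm (Jm (Gm Y Z)) (ι (b W))
      + gm (H W Z) (Jm (ι (a Y))) - gm (H Y Z) (Jm (ι (a W)))) • Jm (ι (a X))
  + gm (ι (a X)) (ι Z) •
      (Jm (ι (b (tanOf z ι (Jm (Gm W Y))))) + (1 / 2 : ℝ) • Gm Y (b W) - (1 / 2 : ℝ) • Gm W (b Y)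
        + H W (a Y) - H Y (a W))
  + gm (ι (b X)) (ι Z) •
      (-Jm (ι (a (tanOf z ι (Jm (Gm W Y))))) + (1 / 2 : ℝ) • Gm W (a Y) - (1 / 2 : ℝ) • Gm Y (a W)
        + H W (b Y) - H Y (b W))

theorem P_mul {z : HH} (hz : z ∈ S3S3) (u : HH) : P z (z * u) = z * P 1 u := by
  obtain ⟨h1, h2⟩ := mul_ne hz
  ext1 <;> simp [P, h1, h2, mul_assoc]

/-- `G` differentiates over a full neighbourhood in ℍ × ℍ, so invariance is needed off `S3S3` too.
-/
theorem J_mul_of_ne {z : HH} (h1 : z.1 ≠ 0) (h2 : z.2 ≠ 0) (u : HH) :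
    J z (z * u) = z * J 1 u := by
  ext1 <;> simp [J, h1, h2, mul_assoc, mul_add, mul_sub]

theorem G_mul {z : HH} (hz : z ∈ S3S3) (u v : HH) :
    G z (z * u) (z * v) = z * Gₗ u v := by
  obtain ⟨h1, h2⟩ := mul_ne hz
  have hne : ∀ᶠ w : HH in nhds z, w.1 ≠ 0 ∧ w.2 ≠ 0 :=
    (continuous_fst.continuousAt.eventually_ne h1).and
      (continuous_snd.continuousAt.eventually_ne h2)
  -- Both left-translated fields are locally constant, so only the Levi-Civita product survives in
  -- `nabla`.
  have c1 : (fun w : HH => w⁻¹ * J w (w * v)) =ᶠ[nhds z] fun _ => J 1 v := by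
    filter_upwards [hne] with w hw
    rw [J_mul_of_ne hw.1 hw.2]
    ext1 <;> simp [hw.1, hw.2]
  have c2 : (fun w : HH => w⁻¹ * (w * v)) =ᶠ[nhds z] fun _ => v := by
    filter_upwards [hne] with w hw
    ext1 <;> simp [hw.1, hw.2]
  simp only [G, nabla, inv_mul_self hz, J_mul hz]
  rw [c1.fderiv_eq, c2.fderiv_eq]
  simp only [fderiv_fun_const, Pi.zero_apply, _root_.zero_apply, zero_add, fderiv_fun_id,
    ContinuousLinearMap.id_apply, inv_mul_self hz, ← mul_sub]
  rfl

theorem tanOf_mul {z : HH} (hz : z ∈ S3S3) (τ : E3 → HH) (Z : HH) :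
    tanOf z (fun u => z * τ u) (z * Z) = tanOf 1 τ Z := by
  simp only [tanOf, g_mul hz]

theorem one_mem_S3S3 : (1 : HH) ∈ S3S3 := by simp [S3S3]

theorem G_one (u v : HH) : G 1 u v = Gₗ u v := by
  simpa using G_mul one_mem_S3S3 u v

theorem summandOf_mul {z : HH} (hz : z ∈ S3S3) (τ : E3 → HH) (H : E3 → E3 → HH) (W X Y Z : E3) :
    summandOf z (fun u => z * τ u) (fun u v => z * H u v) W X Y Z =
      z * summandOf 1 τ H W X Y Z := by
  simp only [summandOf, P_mul hz, J_mul hz, g_mul hz, G_mul hz, G_one, ← mul_neg, tanOf_mul hz,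
    ← mul_smul_comm, ← mul_add, ← mul_sub]

/-! ### Lagrangian subspaces of the Lie algebra. -/

section

variable {τ : E3 →ₗ[ℝ] HH}

/-- The metric induced on `E3` by a linear map to the Lie algebra. -/
noncomputable def gram (τ : E3 →ₗ[ℝ] HH) : E3 →ₗ[ℝ] E3 →ₗ[ℝ] ℝ := gForm.compl₁₂ τ τ

theorem gram_apply (u v : E3) : gram τ u v = gForm (τ u) (τ v) := rfl

theorem gram_comm (u v : E3) : gram τ u v = gram τ v u := gForm_comm _ _

theorem gram_self_pos (hinj : Function.Injective τ) (u : E3) (hu : u ≠ 0) : 0 < gram τ u u :=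
  gForm_self_pos ((map_ne_zero_iff τ hinj).2 hu)

/-- The tangential part, as a linear map. -/
noncomputable def tanₗ (τ : E3 →ₗ[ℝ] HH) : HH →ₗ[ℝ] E3 where
  toFun := tanOf 1 τ
  map_add' u v := by
    simp only [tanOf, sharp, ← gForm_apply, map_add, LinearMap.add_apply, mul_add, add_smul,
      Finset.sum_add_distrib]
  map_smul' c u := by
    simp only [tanOf, sharp, ← gForm_apply, map_smul, LinearMap.smul_apply, smul_eq_mul,
      Finset.smul_sum, smul_smul, RingHom.id_apply, mul_left_comm]

theorem tanₗ_apply (Z : HH) : tanₗ τ Z = tanOf 1 τ Z := rfl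

theorem gram_tanₗ (hinj : Function.Injective τ) (Z : HH) (w : E3) :
    gram τ (tanₗ τ Z) w = gForm Z (τ w) :=
  sharp_spec gram_comm (gram_self_pos hinj) ((gForm Z).comp τ) w

theorem eq_zero_of_gram (hinj : Function.Injective τ) {u : E3} (hu : ∀ w, gram τ u w = 0) :
    u = 0 := by
  by_contra hne
  exact (gram_self_pos hinj u hne).ne' (hu u)

/-- The upper bound suffices: the reverse one comes from the injection of T ⊕ JT. -/
theorem finrank_imag : Module.finrank ℝ imag ≤ 6 := by
  let φ : imag →ₗ[ℝ] (Fin 6 → ℝ) :=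
    { toFun := fun u => ![u.1.1.imI, u.1.1.imJ, u.1.1.imK, u.1.2.imI, u.1.2.imJ, u.1.2.imK]
      map_add' := fun u v => by ext i; fin_cases i <;> simp
      map_smul' := fun c u => by ext i; fin_cases i <;> simp }
  have hφ : Function.Injective φ := by
    rintro ⟨u, hu⟩ ⟨v, hv⟩ huv
    have h := fun i => congrFun huv i
    have h0 := h 0
    have h1 := h 1
    have h2 := h 2
    have h3 := h 3
    have h4 := h 4
    have h5 := h 5
    simp [φ] at h0 h1 h2 h3 h4 h5
    rw [Subtype.mk.injEq]
    ext
    · rw [hu.1, hv.1]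
    · exact h0
    · exact h1
    · exact h2
    · rw [hu.2, hv.2]
    · exact h3
    · exact h4
    · exact h5
  simpa using LinearMap.finrank_le_finrank_of_injective hφ

/-- A vector of the Lie algebra is the sum of its tangential and normal parts. -/
theorem eq_tanₗ_sub (hinj : Function.Injective τ) (him : ∀ u, τ u ∈ imag)
    (hlag : ∀ u v, gForm (Jₗ (τ u)) (τ v) = 0) {Z : HH} (hZ : Z ∈ imag) :
    Z = τ (tanₗ τ Z) - Jₗ (τ (tanₗ τ (Jₗ Z))) := by
  let ψ : E3 × E3 →ₗ[ℝ] imag := LinearMap.codRestrict imag (τ.coprod (Jₗ.comp τ)) fun x =>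
    imag.add_mem (him x.1) (Jₗ_mem (him x.2))
  have hlag' : ∀ u v, gForm (τ u) (Jₗ (τ v)) = 0 := fun u v => by
    rw [← neg_eq_zero, ← gForm_Jₗ_left, hlag]
  have hψ : Function.Injective ψ := by
    rw [← LinearMap.ker_eq_bot, LinearMap.ker_eq_bot']
    -- T and JT are orthogonal by the Lagrangian condition, so their sum is direct; dimension 3 + 3
    -- then fills the Lie algebra.
    rintro ⟨u, v⟩ huv
    have huv' : τ u + Jₗ (τ v) = 0 := congrArg Subtype.val huv
    have hu : u = 0 := eq_zero_of_gram hinj fun w => by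
      have := congrArg (fun Z => gForm Z (τ w)) huv'
      simpa [hlag, gram_apply] using this
    have hv : v = 0 := eq_zero_of_gram hinj fun w => by
      have := congrArg (fun Z => gForm Z (Jₗ (τ w))) huv'
      simpa [hlag', gram_apply, gForm_Jₗ_Jₗ] using this
    rw [hu, hv]; rfl
  have hfr : Module.finrank ℝ (E3 × E3) = Module.finrank ℝ imag := by
    refine le_antisymm (LinearMap.finrank_le_finrank_of_injective hψ) ?_
    simpa using finrank_imag
  obtain ⟨⟨u, v⟩, huv⟩ :=
    (LinearMap.injective_iff_surjective_of_finrank_eq_finrank hfr).1 hψ ⟨Z, hZ⟩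
  have huv' : τ u + Jₗ (τ v) = Z := congrArg Subtype.val huv
  have h1 : tanₗ τ Z = u := by
    rw [← sub_eq_zero]
    refine eq_zero_of_gram hinj fun w => ?_
    rw [map_sub, LinearMap.sub_apply, gram_tanₗ hinj, ← huv', map_add, LinearMap.add_apply, hlag,
      add_zero, gram_apply, sub_self]
  have h2 : tanₗ τ (Jₗ Z) = -v := by
    rw [← sub_eq_zero]
    refine eq_zero_of_gram hinj fun w => ?_
    rw [map_sub, LinearMap.sub_apply, gram_tanₗ hinj, ← huv', map_add, map_add,
      LinearMap.add_apply, hlag, Jₗ_Jₗ, map_neg, map_neg, LinearMap.neg_apply,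
      LinearMap.neg_apply, gram_apply]
    ring
  rw [h1, h2, map_neg, map_neg, sub_neg_eq_add, huv']

/-- The cyclic identity for a Lagrangian subspace of the Lie algebra with a second fundamental form
that satisfies the Gauss equation of a space of constant curvature. -/
theorem cyclic_sum_summandOf_one (hinj : Function.Injective τ) (him : ∀ u, τ u ∈ imag)
    (hlag : ∀ u v, gForm (Jₗ (τ u)) (τ v) = 0) {H : E3 →ₗ[ℝ] E3 →ₗ[ℝ] HH}
    (hHim : ∀ u v, H u v ∈ imag) (hHn : ∀ u v w, gForm (H u v) (τ w) = 0)
    (hH1 : ∀ u v, H u v = H v u)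
    (hH2 : ∀ u v w, gForm (H u v) (Jₗ (τ w)) = gForm (H u w) (Jₗ (τ v)))
    (hG : ∀ u v w, gForm (Gₗ (τ u) (τ v)) (τ w) = 0) {c : ℝ}
    (hgauss : ∀ u v p q, gForm (ambientCurv (τ u) (τ v) (τ p)) (τ q) =
      c * (gram τ v p * gram τ u q - gram τ u p * gram τ v q)
        - (gForm (H v p) (H u q) - gForm (H u p) (H v q))) (W X Y Z : E3) :
    summandOf 1 τ (fun u v => H u v) W X Y Z + summandOf 1 τ (fun u v => H u v) X Y W Z
      + summandOf 1 τ (fun u v => H u v) Y W X Z = 0 := by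
  have hlag' : ∀ u v, gForm (τ u) (Jₗ (τ v)) = 0 := fun u v => by
    rw [← neg_eq_zero, ← gForm_Jₗ_left, hlag]
  let A : E3 →ₗ[ℝ] E3 := (tanₗ τ).comp (Pₗ.comp τ)
  let B : E3 →ₗ[ℝ] E3 := (tanₗ τ).comp ((-Jₗ).comp (Pₗ.comp τ))
  let K : E3 →ₗ[ℝ] E3 →ₗ[ℝ] E3 := H.compr₂ ((tanₗ τ).comp (-Jₗ))
  let S : E3 →ₗ[ℝ] E3 →ₗ[ℝ] E3 := (Gₗ.compl₁₂ τ τ).compr₂ ((tanₗ τ).comp Jₗ)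
  have hAe : ∀ u, tanₗ τ (Pₗ (τ u)) = A u := fun u => rfl
  have hBe : ∀ u, tanₗ τ (-Jₗ (Pₗ (τ u))) = B u := fun u => rfl
  have hKe : ∀ u v, tanₗ τ (-Jₗ (H u v)) = K u v := fun u v => rfl
  have hSe : ∀ u v, tanₗ τ (Jₗ (Gₗ (τ u) (τ v))) = S u v := fun u v => rfl
  have hP : ∀ u, Pₗ (τ u) = τ (A u) + Jₗ (τ (B u)) := fun u => by
    conv_lhs => rw [eq_tanₗ_sub hinj him hlag (Pₗ_mem (him u))]
    rw [← hAe, ← hBe, map_neg (tanₗ τ), map_neg τ, map_neg Jₗ, sub_eq_add_neg]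
  have hHK : ∀ u v, H u v = Jₗ (τ (K u v)) := fun u v => by
    have h0 : tanₗ τ (H u v) = 0 := eq_zero_of_gram hinj fun w => by rw [gram_tanₗ hinj, hHn]
    conv_lhs => rw [eq_tanₗ_sub hinj him hlag (hHim u v), h0]
    rw [← hKe, map_neg (tanₗ τ), map_neg τ, map_neg Jₗ, map_zero, zero_sub]
  have hGS : ∀ u v, Jₗ (Gₗ (τ u) (τ v)) = τ (S u v) := fun u v => by
    have h0 : tanₗ τ (Gₗ (τ u) (τ v)) = 0 := eq_zero_of_gram hinj fun w => by
      rw [gram_tanₗ hinj, hG]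
    conv_lhs => rw [eq_tanₗ_sub hinj him hlag (Jₗ_mem (Gₗ_mem (τ u) (τ v)))]
    rw [hSe, Jₗ_Jₗ, map_neg (tanₗ τ), h0, neg_zero, map_zero, map_zero, sub_zero]
  have hGS' : ∀ u v, Gₗ (τ u) (τ v) = -Jₗ (τ (S u v)) := fun u v => by
    rw [← hGS, Jₗ_Jₗ, neg_neg]
  have hbA : ∀ u v, gForm (Pₗ (τ u)) (τ v) = gram τ (A u) v := fun u v => by
    rw [← hAe, gram_tanₗ hinj]
  have hbB : ∀ u v, gForm (Jₗ (Pₗ (τ u))) (τ v) = -gram τ (B u) v := fun u v => by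
    rw [← hBe, gram_tanₗ hinj, map_neg, LinearMap.neg_apply, neg_neg]
  have hA : ∀ u v, gram τ (A u) v = gram τ u (A v) := fun u v => by
    rw [gram_comm u, ← hbA, ← hbA, gForm_Pₗ_left, gForm_comm]
  have hB : ∀ u v, gram τ (B u) v = gram τ u (B v) := fun u v => by
    rw [gram_comm u, ← neg_inj, ← hbB, ← hbB, gForm_Jₗ_left, gForm_Pₗ_left, Pₗ_Jₗ, map_neg,
      neg_neg, gForm_comm]
  -- With PJ = -JP, the JT component of P(Pu) = u is BAu - ABu = 0.
  have hAB : ∀ u, A (B u) = B (A u) := fun u => by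
    rw [← sub_eq_zero]
    refine eq_zero_of_gram hinj fun w => ?_
    have h1 := Pₗ_Pₗ (τ u)
    rw [hP u, map_add, Pₗ_Jₗ, hP, hP, map_add, Jₗ_Jₗ] at h1
    have h2 := congrArg (fun Z => gForm Z (Jₗ (τ w))) h1
    simp only [map_add, map_neg, LinearMap.add_apply, LinearMap.neg_apply, hlag',
      gForm_Jₗ_Jₗ] at h2
    simp only [map_sub, LinearMap.sub_apply, gram_apply]
    linear_combination -h2
  have hbS : ∀ u v w, gram τ (S u v) w = gForm (Jₗ (Gₗ (τ u) (τ v))) (τ w) := fun u v w => by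
    rw [hGS]; rfl
  have hS1 : ∀ u v w, gram τ (S u v) w = -gram τ (S v u) w := fun u v w => by
    rw [hbS, hbS, Gₗ_swap, map_neg, map_neg, LinearMap.neg_apply]
  have hS2 : ∀ u v w, gram τ (S u v) w = -gram τ (S u w) v := fun u v w => by
    rw [hbS, hbS, gForm_Jₗ_Gₗ_swap]
  have hK1 : ∀ u v, K u v = K v u := fun u v => by rw [← hKe, ← hKe, hH1]
  have hbK : ∀ u v w, gForm (H u v) (Jₗ (τ w)) = gram τ (K u v) w := fun u v w => by
    rw [hHK, gForm_Jₗ_Jₗ]; rfl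
  have hK2 : ∀ u v w, gram τ (K u v) w = gram τ (K u w) v := fun u v w => by
    rw [← hbK, ← hbK, hH2]
  -- Three times the Gauss equation, which clears the coefficient 1/3 of the P terms; 5/4 is 3 ·
  -- 5/12.
  have hQ : ∀ u v p q, gram τ (A v) p * gram τ (A u) q - gram τ (A u) p * gram τ (A v) q
        + (gram τ (B v) p * gram τ (B u) q - gram τ (B u) p * gram τ (B v) q) =
      (3 * c - 5 / 4) * (gram τ v p * gram τ u q - gram τ u p * gram τ v q)
        - 3 * (gram τ (K v p) (K u q) - gram τ (K u p) (K v q)) := fun u v p q => by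
    have h1 := hgauss u v p q
    rw [gForm_ambientCurv (him u) (him v) (him p) (him q)] at h1
    simp only [hlag, hbA, hbB, hHK, gForm_Jₗ_Jₗ, ← gram_apply] at h1
    linear_combination 3 * h1
  have htan : ∀ u, tanₗ τ (τ u) = u := fun u => by
    rw [← sub_eq_zero]
    refine eq_zero_of_gram hinj fun w => ?_
    rw [map_sub, LinearMap.sub_apply, gram_tanₗ hinj, gram_apply, sub_self]
  -- From JG = S follows G = -JS, hence the opposite signs of the halved S terms in
  -- `tangentSummand`.
  have hsum : ∀ W X Y, summandOf 1 τ (fun u v => H u v) W X Y Z =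
      Jₗ (τ (tangentSummand (gram τ) A B S K W X Y Z)) := fun W X Y => by
    simp only [summandOf, G_one, ← gForm_apply, ← Jₗ_apply, ← Pₗ_apply, ← tanₗ_apply, hAe, hBe,
      hGS', hbK, ← gram_apply, tangentSummand, map_add, map_sub, map_neg, map_smul, Jₗ_Jₗ, neg_neg,
      htan]
    simp only [hHK]
    module
  rw [hsum, hsum, hsum, ← map_add, ← map_add, ← map_add, ← map_add,
    cyclic_sum_tangentSummand gram_comm (gram_self_pos hinj) hA hB hAB hS1 hS2 hK1 hK2 hQ,
    map_zero, map_zero]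

end

/-! ### Lagrangian immersions through the Maurer-Cartan form. -/

/-- The map `F : E3 → S³ × S³` is a smooth Lagrangian immersion at `y`. -/
structure IsLagrangianAt (F : E3 → HH) (y : E3) : Prop where
  smooth : ContDiffAt ℝ ∞ F y
  mem : F y ∈ S3S3
  immersion : Function.Injective (fderiv ℝ F y)
  lagrangian : ∀ u v, g (F y) (J (F y) (fderiv ℝ F y u)) (fderiv ℝ F y v) = 0

/-- The pull-back of the Maurer-Cartan form by `F`. -/
noncomputable def mc (F : E3 → HH) (y : E3) : E3 →L[ℝ] HH :=
  (ContinuousLinearMap.mul ℝ HH (F y)⁻¹).comp (fderiv ℝ F y)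

theorem mc_apply (F : E3 → HH) (y u : E3) : mc F y u = (F y)⁻¹ * fderiv ℝ F y u := rfl

/-- The covariant derivative of left-translated vector fields along `F`. -/
noncomputable def covDeriv (F : E3 → HH) (u : E3) (Y : E3 → HH) (y : E3) : HH :=
  fderiv ℝ Y y u + lcₗ (mc F y u) (Y y)

theorem two_le_infty : (2 : WithTop ℕ∞) ≤ ∞ :=
  WithTop.coe_le_coe.2 (le_top : (2 : ℕ∞) ≤ ⊤)

theorem one_add_one_le_infty : (1 : WithTop ℕ∞) + 1 ≤ ∞ :=
  one_add_one_eq_two (R := WithTop ℕ∞) ▸ two_le_infty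

theorem contDiffAt_inv_HH {F : E3 → HH} {y : E3} (hF : ContDiffAt ℝ ∞ F y) (h1 : (F y).1 ≠ 0)
    (h2 : (F y).2 ≠ 0) : ContDiffAt ℝ ∞ (fun y => (F y)⁻¹) y := by
  have key : ∀ {f : E3 → ℍ[ℝ]}, ContDiffAt ℝ ∞ f y → f y ≠ 0 →
      ContDiffAt ℝ ∞ (fun y => (f y)⁻¹) y := by
    intro f hf h0
    have h := (contDiffAt_ringInverse ℝ (n := ∞) (Units.mk0 (f y) h0))
    have := ContDiffAt.comp (g := Ring.inverse) y h hf
    simpa [Function.comp_def, Ring.inverse_eq_inv'] using this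
  exact (key hF.fst h1).prodMk (key hF.snd h2)

section

variable {F : E3 → HH} {x : E3}

theorem IsLagrangianAt.contDiffAt_mc (hF : IsLagrangianAt F x) : ContDiffAt ℝ ∞ (mc F) x := by
  obtain ⟨h1, h2⟩ := mul_ne hF.mem
  exact ((ContinuousLinearMap.contDiff (ContinuousLinearMap.mul ℝ HH)).contDiffAt.comp x
    (contDiffAt_inv_HH hF.smooth h1 h2)).clm_comp (hF.smooth.fderiv_right (by simp))

theorem IsLagrangianAt.differentiableAt_mc (hF : IsLagrangianAt F x) :
    DifferentiableAt ℝ (mc F) x := hF.contDiffAt_mc.differentiableAt (by simp)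

theorem IsLagrangianAt.differentiableAt_mc_apply (hF : IsLagrangianAt F x) (u : E3) :
    DifferentiableAt ℝ (fun y => mc F y u) x :=
  hF.differentiableAt_mc.clm_apply (differentiableAt_const u)

theorem IsLagrangianAt.differentiableAt_fderiv_mc (hF : IsLagrangianAt F x) :
    DifferentiableAt ℝ (fderiv ℝ (mc F)) x :=
  (hF.contDiffAt_mc.fderiv_right (m := 1) one_add_one_le_infty).differentiableAt (by simp)

theorem IsLagrangianAt.fderiv_mc_apply (hF : IsLagrangianAt F x) (u v : E3) :
    fderiv ℝ (fun y => mc F y v) x u = fderiv ℝ (mc F) x u v := by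
  rw [fderiv_clm_apply hF.differentiableAt_mc (differentiableAt_const v)]
  simp

theorem IsLagrangianAt.mul_mc (hF : IsLagrangianAt F x) (u : E3) :
    F x * mc F x u = fderiv ℝ F x u := mul_inv_self hF.mem _

/-- The Maurer-Cartan equation. -/
theorem IsLagrangianAt.fderiv_mc_sub (hF : IsLagrangianAt F x) (u v : E3) :
    fderiv ℝ (mc F) x u v - fderiv ℝ (mc F) x v u =
      -(mc F x u * mc F x v - mc F x v * mc F x u) := by
  obtain ⟨h1, h2⟩ := mul_ne hF.mem
  have hF1 : DifferentiableAt ℝ F x := hF.smooth.differentiableAt (by simp)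
  have hF2 : DifferentiableAt ℝ (fderiv ℝ F) x :=
    (hF.smooth.fderiv_right (m := 1) one_add_one_le_infty).differentiableAt (by simp)
  have hd : ∀ w, DifferentiableAt ℝ (fun y => fderiv ℝ F y w) x := fun w =>
    hF2.clm_apply (differentiableAt_const w)
  have hdd : ∀ w w', fderiv ℝ (fun y => fderiv ℝ F y w) x w' = fderiv ℝ (fderiv ℝ F) x w' w := by
    intro w w'
    rw [fderiv_clm_apply hF2 (differentiableAt_const w)]
    simp
  have hs : fderiv ℝ (fderiv ℝ F) x u v = fderiv ℝ (fderiv ℝ F) x v u :=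
    (hF.smooth.isSymmSndFDerivAt (by simpa using two_le_infty)) u v
  rw [← hF.fderiv_mc_apply, ← hF.fderiv_mc_apply]
  simp only [mc_apply]
  rw [fderiv_inv_mul hF1 (hd v) h1 h2, fderiv_inv_mul hF1 (hd u) h1 h2, hdd, hdd, hs]
  noncomm_ring

theorem inv_mul_re {p u : ℍ[ℝ]} (hp : ‖p‖ = 1) : (p⁻¹ * u).re = ⟪p, u⟫_ℝ := by
  have : p⁻¹ = star p := by
    rw [Quaternion.inv_def, Quaternion.normSq_eq_norm_mul_self, hp]
    simp
  rw [this, inner_coords]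
  simp

/-- Differentiating ‖F₁‖² = ‖F₂‖² = 1 makes the derivative orthogonal to the position, and for a
unit p the real part of p⁻¹u is ⟨p, u⟩. -/
theorem mc_mem_imag (hF : ∀ᶠ y in 𝓝 x, IsLagrangianAt F y) (u : E3) : mc F x u ∈ imag := by
  have hx := hF.self_of_nhds
  have hd : DifferentiableAt ℝ F x := hx.smooth.differentiableAt (by simp)
  have key : ∀ {f : E3 → ℍ[ℝ]} {L : E3 →L[ℝ] ℍ[ℝ]}, HasFDerivAt f L x →
      (∀ᶠ y in 𝓝 x, ‖f y‖ = 1) → ⟪f x, L u⟫_ℝ = 0 := by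
    intro f L hf h1
    have h2 : (fun y => ⟪f y, f y⟫_ℝ) =ᶠ[𝓝 x] fun _ => 1 := by
      filter_upwards [h1] with y hy
      rw [real_inner_self_eq_norm_sq, hy]; norm_num
    have h3 := (hf.inner ℝ hf).unique ((hasFDerivAt_const (1 : ℝ) x).congr_of_eventuallyEq h2)
    have h4 := congrArg (fun T => T u) h3
    simpa [real_inner_comm] using h4
  rw [mem_imag, mc_apply]
  simp only [Prod.fst_mul, Prod.snd_mul, Prod.fst_inv, Prod.snd_inv]
  rw [inv_mul_re hx.mem.1, inv_mul_re hx.mem.2]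
  exact ⟨key hd.hasFDerivAt.fst (hF.mono fun y hy => hy.mem.1),
    key hd.hasFDerivAt.snd (hF.mono fun y hy => hy.mem.2)⟩

theorem IsLagrangianAt.mc_injective (hF : IsLagrangianAt F x) : Function.Injective (mc F x) := by
  intro u v huv
  apply hF.immersion
  rw [← hF.mul_mc, ← hF.mul_mc, huv]

theorem IsLagrangianAt.gForm_mc (hF : IsLagrangianAt F x) (u v : E3) :
    gForm (mc F x u) (mc F x v) = g (F x) (fderiv ℝ F x u) (fderiv ℝ F x v) := by
  rw [← hF.mul_mc, ← hF.mul_mc, g_mul hF.mem]; rfl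

theorem IsLagrangianAt.gForm_Jₗ_mc (hF : IsLagrangianAt F x) (u v : E3) :
    gForm (Jₗ (mc F x u)) (mc F x v) = 0 := by
  rw [← hF.lagrangian u v, ← hF.mul_mc, ← hF.mul_mc, J_mul hF.mem, g_mul hF.mem]; rfl

theorem fderiv_gForm {Y Z : E3 → HH} (hY : DifferentiableAt ℝ Y x) (hZ : DifferentiableAt ℝ Z x)
    (u : E3) : fderiv ℝ (fun y => gForm (Y y) (Z y)) x u =
      gForm (fderiv ℝ Y x u) (Z x) + gForm (Y x) (fderiv ℝ Z x u) := by
  have h := gForm.toContinuousBilinearMap.hasFDerivAt_of_bilinear hY.hasFDerivAt hZ.hasFDerivAt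
  have := congrArg (fun T => T u) h.fderiv
  simp only [LinearMap.toContinuousBilinearMap_apply] at this
  rw [this]
  simp [add_comm]

theorem hasFDerivAt_lcₗ {Y Z : E3 → HH} (hY : DifferentiableAt ℝ Y x)
    (hZ : DifferentiableAt ℝ Z x) : ∃ L : E3 →L[ℝ] HH,
      HasFDerivAt (fun y => lcₗ (Y y) (Z y)) L x ∧
      ∀ u, L u = lcₗ (fderiv ℝ Y x u) (Z x) + lcₗ (Y x) (fderiv ℝ Z x u) := by
  have h := lcₗ.toContinuousBilinearMap.hasFDerivAt_of_bilinear hY.hasFDerivAt hZ.hasFDerivAt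
  refine ⟨_, h, fun u => ?_⟩
  simp [add_comm]

theorem gForm_lcₗ (u v w : HH) : gForm (lcₗ u v) w + gForm v (lcₗ u w) = 0 := lcProd_metric u v w

/-- The covariant derivative is compatible with the metric. -/
theorem fderiv_gForm_covDeriv {Y Z : E3 → HH} (hY : DifferentiableAt ℝ Y x)
    (hZ : DifferentiableAt ℝ Z x) (u : E3) : fderiv ℝ (fun y => gForm (Y y) (Z y)) x u =
      gForm (covDeriv F u Y x) (Z x) + gForm (Y x) (covDeriv F u Z x) := by
  rw [fderiv_gForm hY hZ]
  simp only [covDeriv, map_add, LinearMap.add_apply]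
  linear_combination -gForm_lcₗ (mc F x u) (Y x) (Z x)

theorem IsLagrangianAt.covDeriv_mc (hF : IsLagrangianAt F x) (u v : E3) :
    covDeriv F u (fun y => mc F y v) x =
      fderiv ℝ (mc F) x u v + lcₗ (mc F x u) (mc F x v) := by
  rw [covDeriv, hF.fderiv_mc_apply]

/-- Absence of torsion: the Maurer-Cartan bracket cancels the skew part of the Levi-Civita product.
-/
theorem IsLagrangianAt.covDeriv_mc_comm (hF : IsLagrangianAt F x) (u v : E3) :
    covDeriv F u (fun y => mc F y v) x = covDeriv F v (fun y => mc F y u) x := by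
  rw [hF.covDeriv_mc, hF.covDeriv_mc]
  have h1 := hF.fderiv_mc_sub u v
  have h2 : lcₗ (mc F x u) (mc F x v) - lcₗ (mc F x v) (mc F x u) =
    mc F x u * mc F x v - mc F x v * mc F x u := lcProd_symm _ _
  rw [← h2] at h1
  rw [← sub_eq_zero, ← sub_eq_zero.2 h1]
  abel

theorem hasFDerivAt_covDeriv_mc (hF : ∀ᶠ y in 𝓝 x, IsLagrangianAt F y) (v w : E3) :
    ∃ L : E3 →L[ℝ] HH, HasFDerivAt (covDeriv F v fun y => mc F y w) L x ∧
      ∀ u, L u = fderiv ℝ (fderiv ℝ (mc F)) x u v w + (lcₗ (fderiv ℝ (mc F) x u v) (mc F x w)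
        + lcₗ (mc F x v) (fderiv ℝ (mc F) x u w)) := by
  have hx := hF.self_of_nhds
  obtain ⟨L, hL, hL'⟩ := hasFDerivAt_lcₗ (hx.differentiableAt_mc_apply v)
    (hx.differentiableAt_mc_apply w)
  have h0 := HasFDerivAt.clm_apply (𝕜 := ℝ) (c := fderiv ℝ (mc F))
    hx.differentiableAt_fderiv_mc.hasFDerivAt (hasFDerivAt_const v x)
  have h1 := HasFDerivAt.clm_apply (𝕜 := ℝ) (c := fun y => fderiv ℝ (mc F) y v) h0
    (hasFDerivAt_const w x)
  refine ⟨_, (h1.add hL).congr_of_eventuallyEq ?_, fun u => ?_⟩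
  · filter_upwards [hF] with y hy
    exact hy.covDeriv_mc v w
  · simp [hL', hx.fderiv_mc_apply]

/-- The curvature of the covariant derivative. -/
theorem covDeriv_covDeriv_sub (hF : ∀ᶠ y in 𝓝 x, IsLagrangianAt F y) (u v w : E3) :
    covDeriv F u (covDeriv F v fun y => mc F y w) x
      - covDeriv F v (covDeriv F u fun y => mc F y w) x =
    ambientCurv (mc F x u) (mc F x v) (mc F x w) := by
  have hx := hF.self_of_nhds
  obtain ⟨L, hL, hL'⟩ := hasFDerivAt_covDeriv_mc hF v w
  obtain ⟨N, hN, hN'⟩ := hasFDerivAt_covDeriv_mc hF u w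
  have hs : fderiv ℝ (fderiv ℝ (mc F)) x u v = fderiv ℝ (fderiv ℝ (mc F)) x v u :=
    (hx.contDiffAt_mc.isSymmSndFDerivAt (by simpa using two_le_infty)) u v
  -- Second derivatives cancel by symmetry; the Maurer-Cartan equation supplies the bracket term of
  -- `ambientCurv`.
  have h1 : fderiv ℝ (mc F) x u v = fderiv ℝ (mc F) x v u
      - (mc F x u * mc F x v - mc F x v * mc F x u) := by
    rw [sub_eq_add_neg, ← hx.fderiv_mc_sub u v]; abel
  change fderiv ℝ (covDeriv F v fun y => mc F y w) x u
      + lcₗ (mc F x u) (covDeriv F v (fun y => mc F y w) x)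
    - (fderiv ℝ (covDeriv F u fun y => mc F y w) x v
      + lcₗ (mc F x v) (covDeriv F u (fun y => mc F y w) x)) = _
  rw [hL.fderiv, hN.fderiv, hL', hN', hx.covDeriv_mc, hx.covDeriv_mc, hs, h1,
    ambientCurv]
  simp only [map_add, map_sub, LinearMap.sub_apply]
  abel

theorem covDeriv_Jₗ {Y : E3 → HH} (hY : DifferentiableAt ℝ Y x) (u : E3) :
    covDeriv F u (fun y => Jₗ (Y y)) x = Jₗ (covDeriv F u Y x) + Gₗ (mc F x u) (Y x) := by
  have h := (LinearMap.toContinuousLinearMap Jₗ).hasFDerivAt.comp x hY.hasFDerivAt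
  have h' : fderiv ℝ (fun y => Jₗ (Y y)) x u = Jₗ (fderiv ℝ Y x u) := by
    have := congrArg (fun T => T u) h.fderiv
    exact this
  rw [covDeriv, h', covDeriv, Gₗ_apply, map_add]
  abel

/-- For a Lagrangian immersion, `g(∇̃_u F_* v, J F_* w)` is totally symmetric and `G` takes normal
values on tangent vectors. -/
theorem lagrangian_symmetry (hF : ∀ᶠ y in 𝓝 x, IsLagrangianAt F y) :
    (∀ u v w, gForm (covDeriv F u (fun y => mc F y v) x) (Jₗ (mc F x w)) =
      gForm (covDeriv F u (fun y => mc F y w) x) (Jₗ (mc F x v))) ∧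
    ∀ u v w, gForm (Gₗ (mc F x u) (mc F x v)) (mc F x w) = 0 := by
  have hx := hF.self_of_nhds
  -- This is the derivative in the direction u of the Lagrangian condition g(J F_* v, F_* w) = 0.
  have key : ∀ u v w, gForm (covDeriv F u (fun y => mc F y w) x) (Jₗ (mc F x v))
      - gForm (covDeriv F u (fun y => mc F y v) x) (Jₗ (mc F x w))
      + gForm (Gₗ (mc F x u) (mc F x v)) (mc F x w) = 0 := by
    intro u v w
    have hJ : DifferentiableAt ℝ (fun y => Jₗ (mc F y v)) x :=
      ((LinearMap.toContinuousLinearMap Jₗ).hasFDerivAt.comp x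
        (hx.differentiableAt_mc_apply v).hasFDerivAt).differentiableAt
    have h1 := fderiv_gForm_covDeriv (F := F) hJ (hx.differentiableAt_mc_apply w) u
    have h0 : (fun y => gForm (Jₗ (mc F y v)) (mc F y w)) =ᶠ[𝓝 x] fun _ => 0 := by
      filter_upwards [hF] with y hy
      exact hy.gForm_Jₗ_mc v w
    rw [h0.fderiv_eq, covDeriv_Jₗ (hx.differentiableAt_mc_apply v), map_add, LinearMap.add_apply,
      gForm_Jₗ_left, gForm_comm (Jₗ (mc F x v))] at h1
    simp at h1
    linear_combination -h1
  -- Summing `key` cyclically, the connection terms cancel by absence of torsion, while the three G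
  -- terms agree because g(G(u,v),w) is alternating.
  have hT : ∀ u v w, gForm (Gₗ (mc F x u) (mc F x v)) (mc F x w) = 0 := by
    intro u v w
    have k1 := key u v w
    have k2 := key v w u
    have k3 := key w u v
    have s1 : gForm (Gₗ (mc F x v) (mc F x w)) (mc F x u) =
        gForm (Gₗ (mc F x u) (mc F x v)) (mc F x w) := by
      rw [gForm_Gₗ_swap, Gₗ_swap, map_neg, LinearMap.neg_apply, neg_neg]
    have s2 : gForm (Gₗ (mc F x w) (mc F x u)) (mc F x v) =
        gForm (Gₗ (mc F x u) (mc F x v)) (mc F x w) := by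
      rw [Gₗ_swap, map_neg, LinearMap.neg_apply, gForm_Gₗ_swap, neg_neg]
    rw [hx.covDeriv_mc_comm u w] at k1
    rw [hx.covDeriv_mc_comm v u] at k2
    rw [hx.covDeriv_mc_comm w v] at k3
    linarith
  refine ⟨fun u v w => ?_, hT⟩
  have := key u v w
  rw [hT] at this
  linarith

end

/-! ### Induced metric, second fundamental form and the Gauss equation. -/

theorem differentiableAt_matrix_inv {N : E3 → Matrix (Fin 3) (Fin 3) ℝ} {x : E3}
    (hN : ∀ i j, DifferentiableAt ℝ (fun y => N y i j) x) (h0 : (N x).det ≠ 0) (i j : Fin 3) :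
    DifferentiableAt ℝ (fun y => (N y)⁻¹ i j) x := by
  have hdet : DifferentiableAt ℝ (fun y => (N y).det) x := by
    simp only [Matrix.det_fin_three]
    fun_prop
  have hadj : DifferentiableAt ℝ (fun y => (N y).adjugate i j) x := by
    simp only [Matrix.adjugate_fin_three]
    fin_cases i <;> fin_cases j <;> simp <;> fun_prop
  have : (fun y => (N y)⁻¹ i j) = fun y => ((N y).det)⁻¹ * (N y).adjugate i j := by
    ext y
    rw [Matrix.inv_def, Ring.inverse_eq_inv', Matrix.smul_apply, smul_eq_mul]
  rw [this]
  exact (hdet.inv h0).mul hadj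

/-- The metric induced by `F`. -/
noncomputable def metricOf (F : E3 → HH) (y u v : E3) : ℝ :=
  g (F y) (fderiv ℝ F y u) (fderiv ℝ F y v)

section

variable {F : E3 → HH} {x : E3}

theorem differentiableAt_gForm {Y Z : E3 → HH} (hY : DifferentiableAt ℝ Y x)
    (hZ : DifferentiableAt ℝ Z x) : DifferentiableAt ℝ (fun y => gForm (Y y) (Z y)) x :=
  (gForm.toContinuousBilinearMap.hasFDerivAt_of_bilinear hY.hasFDerivAt
    hZ.hasFDerivAt).differentiableAt

/-- Needed because the Christoffel symbols, which are tangential parts, get differentiated in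
`curvature`. -/
theorem IsLagrangianAt.differentiableAt_tanₗ (hF : IsLagrangianAt F x) {Y : E3 → HH}
    (hY : DifferentiableAt ℝ Y x) :
    DifferentiableAt ℝ (fun y => tanₗ (mc F y : E3 →ₗ[ℝ] HH) (Y y)) x := by
  have hN := differentiableAt_matrix_inv (x := x)
    (N := fun y => Matrix.of fun k l => gram (mc F y : E3 →ₗ[ℝ] HH) (e k) (e l))
    (fun i j => differentiableAt_gForm (hF.differentiableAt_mc_apply _)
      (hF.differentiableAt_mc_apply _))
    (gram_det_ne_zero (gram_self_pos hF.mc_injective))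
  have hα : ∀ j, DifferentiableAt ℝ (fun y => gForm (Y y) (mc F y (e j))) x := fun j =>
    differentiableAt_gForm hY (hF.differentiableAt_mc_apply _)
  change DifferentiableAt ℝ (fun y => ∑ i, ∑ j,
    ((Matrix.of fun k l => gram (mc F y : E3 →ₗ[ℝ] HH) (e k) (e l))⁻¹ i j
      * gForm (Y y) (mc F y (e j))) • (e i : E3)) x
  exact DifferentiableAt.fun_sum fun i _ => DifferentiableAt.fun_sum fun j _ =>
    ((hN i j).mul (hα j)).smul_const _

theorem IsLagrangianAt.metricOf_eq (hF : IsLagrangianAt F x) (u v : E3) :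
    metricOf F x u v = gram (mc F x : E3 →ₗ[ℝ] HH) u v := (hF.gForm_mc u v).symm

theorem fderiv_metricOf (hF : ∀ᶠ y in 𝓝 x, IsLagrangianAt F y) (u v w : E3) :
    fderiv ℝ (fun y => metricOf F y v w) x u =
      gForm (covDeriv F u (fun y => mc F y v) x) (mc F x w)
        + gForm (mc F x v) (covDeriv F u (fun y => mc F y w) x) := by
  have hx := hF.self_of_nhds
  rw [← fderiv_gForm_covDeriv (hx.differentiableAt_mc_apply v) (hx.differentiableAt_mc_apply w)]
  have hev : (fun y => metricOf F y v w) =ᶠ[𝓝 x] fun y => gForm (mc F y v) (mc F y w) := by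
    filter_upwards [hF] with y hy
    exact hy.metricOf_eq v w
  rw [hev.fderiv_eq]

/-- The Christoffel symbols are the tangential part of the ambient connection. -/
theorem christoffel_eq (hF : ∀ᶠ y in 𝓝 x, IsLagrangianAt F y) (u v : E3) :
    christoffel (metricOf F) x u v =
      tanₗ (mc F x : E3 →ₗ[ℝ] HH) (covDeriv F u (fun y => mc F y v) x) := by
  have hx := hF.self_of_nhds
  have h1 : metricOf F x = fun u v => g 1 (mc F x u) (mc F x v) := by
    ext u v; exact hx.metricOf_eq u v
  -- Koszul's formula: six terms from metric compatibility, of which four cancel by absence of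
  -- torsion.
  have h2 : (fun w => (1 / 2) * (fderiv ℝ (fun y => metricOf F y v w) x u
      + fderiv ℝ (fun y => metricOf F y u w) x v - fderiv ℝ (fun y => metricOf F y u v) x w)) =
      fun w => g 1 (covDeriv F u (fun y => mc F y v) x) (mc F x w) := by
    ext w
    rw [fderiv_metricOf hF, fderiv_metricOf hF, fderiv_metricOf hF, hx.covDeriv_mc_comm v u,
      hx.covDeriv_mc_comm w u, hx.covDeriv_mc_comm w v, ← gForm_apply,
      gForm_comm (mc F x u), gForm_comm (mc F x v)]
    ring
  rw [christoffel, h1, h2]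
  rfl

/-- The second fundamental form after left translation. -/
noncomputable def secondForm (F : E3 → HH) (x : E3) : E3 →ₗ[ℝ] E3 →ₗ[ℝ] HH :=
  let D : E3 →ₗ[ℝ] E3 →ₗ[ℝ] HH := LinearMap.mk₂ ℝ (fun u v => fderiv ℝ (mc F) x u v)
      (by simp) (by simp) (by simp) (by simp)
    + lcₗ.compl₁₂ (mc F x : E3 →ₗ[ℝ] HH) (mc F x : E3 →ₗ[ℝ] HH)
  D - D.compr₂ ((mc F x : E3 →ₗ[ℝ] HH).comp (tanₗ (mc F x : E3 →ₗ[ℝ] HH)))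

theorem secondForm_apply (hF : ∀ᶠ y in 𝓝 x, IsLagrangianAt F y) (u v : E3) :
    secondForm F x u v = covDeriv F u (fun y => mc F y v) x
      - mc F x (tanₗ (mc F x : E3 →ₗ[ℝ] HH) (covDeriv F u (fun y => mc F y v) x)) := by
  rw [hF.self_of_nhds.covDeriv_mc]
  rfl

theorem gForm_secondForm_mc (hF : ∀ᶠ y in 𝓝 x, IsLagrangianAt F y) (u v w : E3) :
    gForm (secondForm F x u v) (mc F x w) = 0 := by
  rw [secondForm_apply hF, map_sub, LinearMap.sub_apply, sub_eq_zero]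
  exact (gram_tanₗ (τ := (mc F x : E3 →ₗ[ℝ] HH)) hF.self_of_nhds.mc_injective _ w).symm

theorem covDeriv_mc_eq (hF : ∀ᶠ y in 𝓝 x, IsLagrangianAt F y) (u v : E3) :
    covDeriv F u (fun y => mc F y v) x =
      mc F x (christoffel (metricOf F) x u v) + secondForm F x u v := by
  rw [secondForm_apply hF, christoffel_eq hF]
  abel

theorem secondForm_comm (hF : ∀ᶠ y in 𝓝 x, IsLagrangianAt F y) (u v : E3) :
    secondForm F x u v = secondForm F x v u := by
  rw [secondForm_apply hF, secondForm_apply hF, hF.self_of_nhds.covDeriv_mc_comm]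

theorem gForm_secondForm_Jₗ (hF : ∀ᶠ y in 𝓝 x, IsLagrangianAt F y) (u v w : E3) :
    gForm (secondForm F x u v) (Jₗ (mc F x w)) =
      gForm (covDeriv F u (fun y => mc F y v) x) (Jₗ (mc F x w)) := by
  rw [covDeriv_mc_eq hF, map_add, LinearMap.add_apply, gForm_comm (mc F x _),
    hF.self_of_nhds.gForm_Jₗ_mc, zero_add]

theorem secondForm_mem_imag (hF : ∀ᶠ y in 𝓝 x, IsLagrangianAt F y) (u v : E3) :
    secondForm F x u v ∈ imag := by
  have hx := hF.self_of_nhds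
  have h1 : fderiv ℝ (mc F) x u v ∈ imag := by
    have hev : ∀ᶠ y in 𝓝 x, mc F y v ∈ imag :=
      hF.eventually_nhds.mono fun y hy => mc_mem_imag hy v
    rw [← hx.fderiv_mc_apply]
    have hd := (hx.differentiableAt_mc_apply v).hasFDerivAt
    -- A linear form vanishing on `imag` vanishes along the field near x, hence on its derivative;
    -- the two real parts are such forms.
    have key : ∀ T : HH →ₗ[ℝ] ℝ, (∀ a ∈ imag, T a = 0) →
        T (fderiv ℝ (fun y => mc F y v) x u) = 0 := by
      intro T hT
      have h2 := (LinearMap.toContinuousLinearMap T).hasFDerivAt.comp x hd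
      have h3 : (⇑(LinearMap.toContinuousLinearMap T) ∘ fun y => mc F y v) =ᶠ[𝓝 x]
          fun _ => 0 := by
        filter_upwards [hev] with y hy
        exact hT _ hy
      have h4 := h2.unique ((hasFDerivAt_const (0 : ℝ) x).congr_of_eventuallyEq h3)
      exact congrArg (fun S => S u) h4
    exact ⟨key (QuaternionAlgebra.reₗ (-1) 0 (-1) ∘ₗ LinearMap.fst ℝ ℍ[ℝ] ℍ[ℝ]) fun a ha => ha.1,
      key (QuaternionAlgebra.reₗ (-1) 0 (-1) ∘ₗ LinearMap.snd ℝ ℍ[ℝ] ℍ[ℝ]) fun a ha => ha.2⟩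
  rw [secondForm_apply hF, hx.covDeriv_mc]
  exact imag.sub_mem (imag.add_mem h1 (lcₗ_mem _ _)) (mc_mem_imag hF _)

/-- The Gauss equation. -/
theorem gauss_equation (hF : ∀ᶠ y in 𝓝 x, IsLagrangianAt F y) (u v w q : E3) :
    metricOf F x (curvature (metricOf F) x u v w) q =
      gForm (ambientCurv (mc F x u) (mc F x v) (mc F x w)) (mc F x q)
        + (gForm (secondForm F x v w) (secondForm F x u q)
          - gForm (secondForm F x u w) (secondForm F x v q)) := by
  have hx := hF.self_of_nhds
  have hτ : ∀ y a, (mc F y : E3 →ₗ[ℝ] HH) a = mc F y a := fun _ _ => rfl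
  -- Obtained by differentiating g(∇̃_v w, q) along u, with ∇̃_v w itself and with its tangential
  -- part only, and comparing.
  have key : ∀ u v, gram (mc F x : E3 →ₗ[ℝ] HH)
      (fderiv ℝ (fun y => christoffel (metricOf F) y v w) x u
        + christoffel (metricOf F) x u (christoffel (metricOf F) x v w)) q =
      gForm (covDeriv F u (covDeriv F v fun y => mc F y w) x) (mc F x q)
        + gForm (secondForm F x v w) (secondForm F x u q) := by
    intro u v
    obtain ⟨L, hL, -⟩ := hasFDerivAt_covDeriv_mc hF v w
    set Γ : E3 → E3 := fun y => christoffel (metricOf F) y v w with hΓ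
    have hΓd : DifferentiableAt ℝ Γ x := by
      refine (hx.differentiableAt_tanₗ hL.differentiableAt).congr_of_eventuallyEq ?_
      filter_upwards [hF.eventually_nhds] with y hy
      exact christoffel_eq hy v w
    have hΓm : DifferentiableAt ℝ (fun y => mc F y (Γ y)) x := hx.differentiableAt_mc.clm_apply hΓd
    have hq := hx.differentiableAt_mc_apply q
    have hev : (fun y => gForm (covDeriv F v (fun y => mc F y w) y) (mc F y q)) =ᶠ[𝓝 x]
        fun y => gForm (mc F y (Γ y)) (mc F y q) := by
      filter_upwards [hF.eventually_nhds] with y hy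
      rw [covDeriv_mc_eq hy, map_add, LinearMap.add_apply, gForm_secondForm_mc hy, add_zero]
    have h1 := hev.fderiv_eq (𝕜 := ℝ)
    have h2 := congrArg (fun T => T u) h1
    rw [fderiv_gForm_covDeriv (F := F) hL.differentiableAt hq,
      fderiv_gForm_covDeriv (F := F) hΓm hq] at h2
    -- Product rule: the derivative of Γ, plus the covariant derivative with Γ frozen at x.
    have h3 : covDeriv F u (fun y => mc F y (Γ y)) x =
        mc F x (fderiv ℝ Γ x u) + covDeriv F u (fun y => mc F y (Γ x)) x := by
      rw [hx.covDeriv_mc, covDeriv, fderiv_clm_apply hx.differentiableAt_mc hΓd]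
      simp [add_assoc]
    have h4 : gForm (covDeriv F u (fun y => mc F y (Γ x)) x) (mc F x q) =
        gForm (mc F x (christoffel (metricOf F) x u (Γ x))) (mc F x q) := by
      rw [covDeriv_mc_eq hF, map_add, LinearMap.add_apply, gForm_secondForm_mc hF, add_zero]
    rw [h3, map_add, LinearMap.add_apply, h4, covDeriv_mc_eq hF v w, covDeriv_mc_eq hF u q] at h2
    simp only [map_add, LinearMap.add_apply, gForm_secondForm_mc hF] at h2
    rw [gram_apply, hτ, hτ, map_add, map_add, LinearMap.add_apply]
    linear_combination -h2
  have k1 := key u v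
  have k2 := key v u
  rw [← covDeriv_covDeriv_sub hF, hx.metricOf_eq, curvature]
  simp only [map_add, map_sub, LinearMap.add_apply, LinearMap.sub_apply] at k1 k2 ⊢
  linear_combination k1 - k2

end

/-! ### Tensors of constant curvature -/

section

/-- A tensor with the linearity and the symmetries of a Riemannian curvature tensor. -/
structure IsCurvatureLike {V : Type*} [AddCommGroup V] [Module ℝ V] (T : V → V → V → V → ℝ) :
    Prop where
  add_left : ∀ u u' v p q, T (u + u') v p q = T u v p q + T u' v p q
  smul_left : ∀ (a : ℝ) u v p q, T (a • u) v p q = a * T u v p q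
  swap : ∀ u v p q, T u v p q = -T v u p q
  pair : ∀ u v p q, T u v p q = T p q u v
  bianchi : ∀ u v p q, T u v p q + T v p u q + T p u v q = 0

variable {V : Type*} [AddCommGroup V] [Module ℝ V]

/-- Sectional curvatures determine a curvature tensor: polarizing T(u,v,v,u) = 0 makes T skew in the
second and third slots as well, and Bianchi then reads 3T = 0. -/
theorem IsCurvatureLike.eq_zero {T : V → V → V → V → ℝ} (hT : IsCurvatureLike T)
    (h0 : ∀ u v, LinearIndependent ℝ ![u, v] → T u v v u = 0) (u v p q : V) : T u v p q = 0 := by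
  have hs : ∀ u p q, T u u p q = 0 := fun u p q => by linarith [hT.swap u u p q]
  have h1 : ∀ u v, T u v v u = 0 := by
    intro u v
    by_cases hli : LinearIndependent ℝ ![u, v]
    · exact h0 u v hli
    · rw [LinearIndependent.pair_iff] at hli
      push Not at hli
      obtain ⟨s, t, hst, hne⟩ := hli
      have hl := fun p q => hT.add_left (s • u) (t • v) v p q
      have hl' := fun p q => hT.add_left (s • u) (t • v) u p q
      have hz : ∀ v p q, T 0 v p q = 0 := fun v p q => by
        have := hT.smul_left 0 0 v p q
        simpa using this
      simp only [hst, hz, hT.smul_left, hs, mul_zero, add_zero, zero_add] at hl hl'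
      by_cases hs0 : s = 0
      · have := hl' v u
        rw [hT.swap u v]
        rcases mul_eq_zero.1 this.symm with h | h
        · exact absurd h (hne hs0)
        · rw [h, neg_zero]
      · exact (mul_eq_zero.1 (hl v u).symm).resolve_left hs0
  have hr : ∀ u v p q, T u v p q = -T u v q p := fun u v p q => by
    rw [hT.pair, hT.swap, hT.pair]
  have hadd4 : ∀ u v p q q', T u v p (q + q') = T u v p q + T u v p q' := fun u v p q q' => by
    rw [hr, hT.pair, hT.add_left, hT.pair, hT.pair q', hr u v q, hr u v q']; ring
  have hadd3 : ∀ u v p p' q, T u v (p + p') q = T u v p q + T u v p' q := fun u v p p' q => by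
    rw [hT.pair, hT.add_left, hT.pair, hT.pair p']
  have hadd2 : ∀ u v v' p q, T u (v + v') p q = T u v p q + T u v' p q := fun u v v' p q => by
    rw [hT.swap, hT.add_left, hT.swap, hT.swap v']; ring
  have h2 : ∀ u v q, T u v v q = 0 := by
    intro u v q
    have h := h1 (u + q) v
    rw [hT.add_left, hadd4, hadd4, h1, h1, hT.pair q v v u, hT.swap v u, hr u v q v] at h
    linarith
  have h3 : ∀ u v p q, T u v p q = -T u p v q := by
    intro u v p q
    have h := h2 u (v + p) q
    rw [hadd2, hadd3, hadd3, h2, h2] at h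
    linarith
  have hb := hT.bianchi u v p q
  rw [h3 v p u q, hT.swap v u, hT.swap p u, h3 u p v q] at hb
  linarith

theorem IsCurvatureLike.add {T T' : V → V → V → V → ℝ} (hT : IsCurvatureLike T)
    (hT' : IsCurvatureLike T') (c : ℝ) :
    IsCurvatureLike fun u v p q => T u v p q + c * T' u v p q where
  add_left u u' v p q := by rw [hT.add_left, hT'.add_left]; ring
  smul_left a u v p q := by rw [hT.smul_left, hT'.smul_left]; ring
  swap u v p q := by rw [hT.swap, hT'.swap]; ring
  pair u v p q := by rw [hT.pair, hT'.pair]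
  bianchi u v p q := by linear_combination hT.bianchi u v p q + c * hT'.bianchi u v p q

/-- A Kulkarni-Nomizu square. The metric, P, JP and second-form terms of the Gauss equation all have
this shape, so the symmetries of the induced curvature need no Christoffel computation. -/
theorem isCurvatureLike_of_symm {W : Type*} [AddCommGroup W] [Module ℝ W] {β : W →ₗ[ℝ] W →ₗ[ℝ] ℝ}
    (hβ : ∀ a b, β a b = β b a) {φ : V →ₗ[ℝ] V →ₗ[ℝ] W} (hφ : ∀ u v, φ u v = φ v u) :
    IsCurvatureLike fun u v p q => β (φ v p) (φ u q) - β (φ u p) (φ v q) where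
  add_left u u' v p q := by simp only [map_add, LinearMap.add_apply]; ring
  smul_left a u v p q := by simp only [map_smul, LinearMap.smul_apply, smul_eq_mul]; ring
  swap u v p q := by ring
  pair u v p q := by
    rw [hφ q u, hφ p v, hφ p u, hφ q v, hβ (φ u q)]
  bianchi u v p q := by
    rw [hφ p u, hφ v u, hφ p v, hβ (φ u p), hβ (φ v p), hβ (φ u v)]
    ring

end

/-! ### From constant sectional curvature to the pointwise identity. -/

section

variable {F : E3 → HH} {x : E3}

theorem ambientCurv_eq_of_sectional (hF : ∀ᶠ y in 𝓝 x, IsLagrangianAt F y) {c : ℝ}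
    (hc : ∀ u v : E3, LinearIndependent ℝ ![u, v] → sectional (metricOf F) x u v = c)
    (u v p q : E3) : gForm (ambientCurv (mc F x u) (mc F x v) (mc F x p)) (mc F x q) =
      c * (gram (mc F x : E3 →ₗ[ℝ] HH) v p * gram (mc F x : E3 →ₗ[ℝ] HH) u q
          - gram (mc F x : E3 →ₗ[ℝ] HH) u p * gram (mc F x : E3 →ₗ[ℝ] HH) v q)
        - (gForm (secondForm F x v p) (secondForm F x u q)
          - gForm (secondForm F x u p) (secondForm F x v q)) := by
  have hx := hF.self_of_nhds
  set τ : E3 →ₗ[ℝ] HH := (mc F x : E3 →ₗ[ℝ] HH) with hτ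
  have hτe : ∀ u, mc F x u = τ u := fun _ => rfl
  have hmul : ∀ a b : ℝ, LinearMap.mul ℝ ℝ a b = LinearMap.mul ℝ ℝ b a := fun a b => mul_comm a b
  have t1 := isCurvatureLike_of_symm hmul (φ := gram τ) gram_comm
  have t2 := isCurvatureLike_of_symm hmul (φ := gForm.compl₁₂ (Pₗ.comp τ) τ) fun u v => by
    simp only [LinearMap.compl₁₂_apply, LinearMap.comp_apply]
    rw [gForm_Pₗ_left, gForm_comm]
  have t3 := isCurvatureLike_of_symm hmul (φ := gForm.compl₁₂ (Jₗ.comp (Pₗ.comp τ)) τ)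
    fun u v => by
      simp only [LinearMap.compl₁₂_apply, LinearMap.comp_apply]
      rw [gForm_Jₗ_left, gForm_Pₗ_left, Pₗ_Jₗ, map_neg, neg_neg, gForm_comm]
  have t4 := isCurvatureLike_of_symm gForm_comm (φ := secondForm F x) (secondForm_comm hF)
  have hJ : ∀ u v, gForm (Jₗ (τ u)) (τ v) = 0 := hx.gForm_Jₗ_mc
  have him := fun u => mc_mem_imag hF u
  have hT : ∀ u v p q, metricOf F x (curvature (metricOf F) x u v p) q
      - c * (gram τ v p * gram τ u q - gram τ u p * gram τ v q) = 0 := by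
    -- Coefficients of the ambient curvature formula, with the tensor of constant curvature c
    -- subtracted from the metric term.
    have hcl := ((t4.add t1 (5 / 12 - c)).add t2 (1 / 3)).add t3 (1 / 3)
    have heq : ∀ u v p q, metricOf F x (curvature (metricOf F) x u v p) q
      - c * (gram τ v p * gram τ u q - gram τ u p * gram τ v q) = _ := fun u v p q => by
      rw [gauss_equation hF, gForm_ambientCurv (him u) (him v) (him p) (him q)]
    simp only [heq]
    intro u v p q
    have := hcl.eq_zero (fun u v huv => ?_) u v p q
    · simp only [LinearMap.mul_apply', LinearMap.compl₁₂_apply, LinearMap.comp_apply,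
        gram_apply, hτe, hJ] at this ⊢
      linear_combination this
    · have h1 := hc u v huv
      have h2 := heq u v v u
      have hpos : 0 < gram τ u u * gram τ v v - gram τ u v ^ 2 := by
        have hv : v ≠ 0 := huv.ne_zero 1
        have hvv := gram_self_pos hx.mc_injective v hv
        rw [LinearIndependent.pair_iff] at huv
        -- The squared length of this vector, orthogonal to v, is |v|² times the Gram determinant:
        -- strict Cauchy-Schwarz.
        have hw : gram τ v v • u + (-gram τ u v) • v ≠ 0 := fun h =>
          hvv.ne' (huv _ _ h).1
        have hww := gram_self_pos hx.mc_injective _ hw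
        simp only [map_add, map_smul, LinearMap.add_apply, LinearMap.smul_apply,
          smul_eq_mul] at hww
        have hww' : 0 < gram τ v v * (gram τ u u * gram τ v v - gram τ u v ^ 2) := by
          rw [gram_comm (τ := (mc F x : E3 →ₗ[ℝ] HH)) v u] at hww
          linarith
        exact (pos_iff_pos_of_mul_pos hww').1 hvv
      rw [sectional, hx.metricOf_eq u u, hx.metricOf_eq v v, hx.metricOf_eq u v,
        div_eq_iff hpos.ne'] at h1
      rw [h1] at h2
      simp only [LinearMap.mul_apply', LinearMap.compl₁₂_apply, LinearMap.comp_apply,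
        gram_apply, hτe, hJ, gForm_comm (τ v) (τ u)] at h2 ⊢
      linear_combination -h2
  have h1 := hT u v p q
  rw [gauss_equation hF] at h1
  linear_combination h1

end

section

variable {F : E3 → HH} {x : E3}

/-- The cyclic identity in a chart. -/
theorem cyclic_sum_summandOf (hF : ∀ᶠ y in 𝓝 x, IsLagrangianAt F y) {c : ℝ}
    (hc : ∀ u v : E3, LinearIndependent ℝ ![u, v] → sectional (metricOf F) x u v = c)
    {H : E3 → E3 → HH} (hH : ∀ u v, H u v = F x * secondForm F x u v) (W X Y Z : E3) :
    summandOf (F x) (fderiv ℝ F x) H W X Y Z + summandOf (F x) (fderiv ℝ F x) H X Y W Z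
      + summandOf (F x) (fderiv ℝ F x) H Y W X Z = 0 := by
  have hx := hF.self_of_nhds
  have h1 : ⇑(fderiv ℝ F x) = fun u => F x * (mc F x : E3 →ₗ[ℝ] HH) u := by
    ext1 u; exact (hx.mul_mc u).symm
  have h2 : H = fun u v => F x * secondForm F x u v := by ext1 u; ext1 v; exact hH u v
  obtain ⟨hsymm, hG⟩ := lagrangian_symmetry hF
  rw [h1, h2, summandOf_mul hx.mem, summandOf_mul hx.mem, summandOf_mul hx.mem, ← mul_add,
    ← mul_add, cyclic_sum_summandOf_one hx.mc_injective (mc_mem_imag hF) hx.gForm_Jₗ_mc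
      (secondForm_mem_imag hF) (gForm_secondForm_mc hF) (secondForm_comm hF) ?_ hG
      (ambientCurv_eq_of_sectional hF hc), mul_zero]
  intro u v w
  change gForm _ (Jₗ (mc F x w)) = gForm _ (Jₗ (mc F x v))
  rw [gForm_secondForm_Jₗ hF, gForm_secondForm_Jₗ hF, hsymm]

end

/-! ### Passage from the manifold to its preferred charts. -/

section

variable {M : Type*} [TopologicalSpace M] [ChartedSpace E3 M] {f : M → HH} {m : M}

theorem inChart_self (f : M → HH) (m : M) : inChart f m (extChartAt 𝓘(ℝ, E3) m m) = f m := by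
  simp [inChart]

theorem push_eq [IsManifold 𝓘(ℝ, E3) ∞ M] (hf : IsLagrangian f) :
    push f m = fderiv ℝ (inChart f m) (extChartAt 𝓘(ℝ, E3) m m) := by
  ext1 X
  have hd : MDifferentiableAt 𝓘(ℝ, E3) 𝓘(ℝ, HH) f m := (hf.smooth m).mdifferentiableAt (by simp)
  rw [push, hd.mfderiv]
  simp [inChart, writtenInExtChartAt, fderivWithin_univ, Function.comp_def]
  rfl

/-- The inverse chart has invertible differential on the chart target, so the conditions transfer to
nearby points, where they are differentiated. -/
theorem eventually_isLagrangianAt [IsManifold 𝓘(ℝ, E3) ∞ M] (hf : IsLagrangian f) (m : M) :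
    ∀ᶠ y in 𝓝 (extChartAt 𝓘(ℝ, E3) m m), IsLagrangianAt (inChart f m) y := by
  filter_upwards [extChartAt_target_mem_nhds (I := 𝓘(ℝ, E3)) m] with y hy
  have hs : ContMDiffAt 𝓘(ℝ, E3) 𝓘(ℝ, E3) ∞ (extChartAt 𝓘(ℝ, E3) m).symm y :=
    (contMDiffOn_extChartAt_symm m).contMDiffAt
      ((isOpen_extChartAt_target m).mem_nhds hy)
  have hd : MDifferentiableAt 𝓘(ℝ, E3) 𝓘(ℝ, E3) (extChartAt 𝓘(ℝ, E3) m).symm y :=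
    hs.mdifferentiableAt (by simp)
  have hfd : MDifferentiableAt 𝓘(ℝ, E3) 𝓘(ℝ, HH) f ((extChartAt 𝓘(ℝ, E3) m).symm y) :=
    (hf.smooth _).mdifferentiableAt (by simp)
  have hD : ∀ u, fderiv ℝ (inChart f m) y u = push f ((extChartAt 𝓘(ℝ, E3) m).symm y)
      (mfderiv 𝓘(ℝ, E3) 𝓘(ℝ, E3) (extChartAt 𝓘(ℝ, E3) m).symm y u) := by
    intro u
    rw [← mfderiv_eq_fderiv, inChart, mfderiv_comp y hfd hd]
    rfl
  refine ⟨?_, hf.mem _, ?_, fun u v => ?_⟩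
  · exact contMDiffAt_iff_contDiffAt.1 (ContMDiffAt.comp y (hf.smooth _) hs)
  · intro u v huv
    rw [hD, hD] at huv
    have h1 := hf.immersion _ huv
    have hinv : (mfderiv 𝓘(ℝ, E3) 𝓘(ℝ, E3) (extChartAt 𝓘(ℝ, E3) m).symm y).IsInvertible := by
      have := isInvertible_mfderivWithin_extChartAt_symm (I := 𝓘(ℝ, E3)) hy
      simpa using this
    exact hinv.injective h1
  · rw [hD, hD]
    exact hf.lagrangian _ _ _

theorem h_eq [IsManifold 𝓘(ℝ, E3) ∞ M] (hf : IsLagrangian f) (m : M) (X Y : E3) :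
    h f m X Y = inChart f m (extChartAt 𝓘(ℝ, E3) m m) *
      secondForm (inChart f m) (extChartAt 𝓘(ℝ, E3) m m) X Y := by
  have hF := eventually_isLagrangianAt hf m
  have hx := hF.self_of_nhds
  set F := inChart f m
  set x := extChartAt 𝓘(ℝ, E3) m m
  have hD : nabla F (fun y : E3 => fderiv ℝ F y Y) x X =
      F x * covDeriv F X (fun y => mc F y Y) x := rfl
  have ht : ∀ Z, tan f m (F x * Z) = tanₗ (mc F x : E3 →ₗ[ℝ] HH) Z := by
    intro Z
    have : tan f m (F x * Z) = tanOf (f m) (push f m) (F x * Z) := rfl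
    rw [this, push_eq hf, ← inChart_self f m, tanₗ_apply, ← tanOf_mul hx.mem]
    congr 1
    ext1 u
    exact (hx.mul_mc u).symm
  have hh : h f m X Y = nabla F (fun y : E3 => fderiv ℝ F y Y) x X
    - push f m (tan f m (nabla F (fun y : E3 => fderiv ℝ F y Y) x X)) := rfl
  rw [hh, hD, ht, push_eq hf, secondForm_apply hF, mul_sub]
  congr 1
  exact (hx.mul_mc _).symm

end
end NK

theorem lemma5p1 {M : Type*} [TopologicalSpace M] [ChartedSpace NK.E3 M]
    [IsManifold 𝓘(ℝ, NK.E3) ∞ M] (f : M → NK.HH) (hf : NK.IsLagrangian f)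
    (hc : NK.HasConstantSectionalCurvature f) (m : M)
    (W X Y Z : TangentSpace 𝓘(ℝ, NK.E3) m) :
    NK.summand f m W X Y Z + NK.summand f m X Y W Z + NK.summand f m Y W X Z = 0 := by
  obtain ⟨c, hc⟩ := hc
  have key := NK.cyclic_sum_summandOf (NK.eventually_isLagrangianAt hf m) (hc m)
    (NK.h_eq hf m) W X Y Z
  rw [NK.inChart_self, ← NK.push_eq hf] at key
  -- `summand` unfolds to `summandOf` at f(m), with `push` as parametrization and `h` as second
  -- fundamental form.
  exact key
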